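/- **Definitions.** $\mathcal{OG}(4)$ is the family of pairs $(\Gamma,G)$ where $\Gamma$ is a finite connected simple graph of valency $4$ and $G\le\mathrm{Aut}(\Gamma)$ is transitive on vertices and on edges, with a specified $G$-orbit $\Delta$ on ordered vertex pairs containing exactly one ordered pair for each edge; the edge $\{x,y\}$ is oriented $x\to y$ if $(x,y)\in\Delta$. For $N\trianglelefteq G$, the normal quotient $\Gamma_N$ has the $N$-orbits on vertices as its vertices, distinct $N$-orbits $B,C$ being adjacent if some edge of $\Gamma$ joins a vertex of $B$ to a vertex of $C$. It is $G$-oriented if, for all adjacent $B,C$, all edges between $B$ and $C$ have the same orientation, and $G$-unoriented otherwise. $\tilde N$ denotes the group of all elements of $G$ fixing each $N$-orbit setwise. Normal quotients $\Gamma_N,\Gamma_M$ that are cycles are independent if $\Gamma_{\tilde N\cap\tilde M}$ is not a cycle. $(\Gamma,G)$ is a normal cover of $(\Gamma_T,G/T)$ if, for all adjacent $T$-orbits $B,C$, each vertex of $B$ is joined to exactly one vertex of $C$. An isomorphism $(\Gamma,G)\to(\Gamma',G')$ is a graph isomorphism $f$ together with a group isomorphism $\varphi:G\to G'$ such that $f(x^g)=f(x)^{\varphi(g)}$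 for all $x,g$, and such that $f$ maps the specified orientation of $\Gamma$ to that of $\Gamma'$. For $r,s\ge3$ let $X=\mathbb Z_r\times\mathbb Z_s$ and let $\Gamma(r,s)$ be the graph on $X$ in which $(i,j)$ is joined to the four vertices $(i\pm1,j\pm1)$. Put $\mu:(i,j)\mapsto(i+1,j)$, $\nu:(i,j)\mapsto(i,j+1)$, $\sigma:(i,j)\mapsto(-i,j)$, $\tau:(i,j)\mapsto(-i,-j)$, where products act from left to right. * $G(r,s)=\langle\mu,\nu,\sigma\rangle$, with orientation $(i,j)\to(i\pm1,j+1)$. * For $s$ even, $H(r,s)=\langle\mu,\sigma\nu,\tau\rangle$, with orientation $(i,j)\to(i+1,j+(-1)^j)$ and $(i,j)\to(i-1,j-(-1)^j)$. * For $r,s$ both even, $\Gamma^+(r,s)$ is the subgraph of $\Gamma(r,s)$ induced on $X^+=\{(i,j): i,j \text{ of the same parity}\}$, and, acting on $X^+$, $G^+(r,s)=\langle\mu^2,\mu\nu,\sigma\rangle$ and $H^+(r,s)=\langle\mu^2,\sigma\mu\nu,\tau\rangle$, with the orientations restricted from those for $G(r,s)$ and $H(r,s)$ respectively. * $\Gamma_2(r,s)$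 is the standard double cover of $\Gamma(r,s)$: its vertices are $(i,j)_\delta$ with $(i,j)\in X$ and $\delta\in\mathbb Z_2$, and $x_\delta,y_{\delta'}$ are adjacent if and only if $\delta\ne\delta'$ and $x,y$ are adjacent in $\Gamma(r,s)$. $G_2(r,s)$ is generated by $(i,j)_\delta\mapsto(i+1,j)_\delta$, $(i,j)_\delta\mapsto(i,j+1)_\delta$, $(i,j)_\delta\mapsto(i,-j)_{\delta+1}$ and $(i,j)_\delta\mapsto(-i,-j)_\delta$. The orientation is $(i,j)_\delta\to(i+1,j+(-1)^\delta)_{\delta+1}$ and $(i,j)_\delta\to(i-1,j-(-1)^\delta)_{\delta+1}$. **Theorem.** Let $(\Gamma,G)\in\mathcal{OG}(4)$, let $x$ be a vertex, and suppose that $(\Gamma,G)$ has independent cyclic normal quotients $\Gamma_N\cong C_r$ and $\Gamma_M\cong C_s$, where $r,s\ge3$. Then $G_x\cong Z_2$, and the following hold. (a) At least one of $\Gamma_N,\Gamma_M$ is $G$-unoriented. (b) Let $T=\tilde N\cap\tilde M$, $\bar\Gamma=\Gamma_T$, $\bar G=G/T$ (with the orientation induced from $\Gamma$), $\bar N=\tilde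 N/T$ and $\bar M=\tilde M/T$. Then $(\Gamma,G)$ is a normal cover of $(\bar\Gamma,\bar G)$, and $(\bar\Gamma,\bar G)\in\mathcal{OG}(4)$ has independent cyclic normal quotients $\bar\Gamma_{\bar N}\cong C_r$ and $\bar\Gamma_{\bar M}\cong C_s$, with $\bar N\cap\bar M=1$. (c) Suppose that $\Gamma_N$ is $G$-unoriented (by (a), this holds after interchanging $(N,r)$ and $(M,s)$ if necessary). Then $(\bar\Gamma,\bar G)$ is isomorphic to the pair in one of the following lines, with the stated conditions on $r,s$ holding; and $\bar\Gamma_{\bar M}$ is $\bar G$-oriented, equivalently $\Gamma_M$ is $G$-oriented, if and only if the entry in that line is "yes": 1. $(\Gamma(r,s),G(r,s))$: yes; at least one of $r,s$ odd. 2. $(\Gamma^+(r,s),G^+(r,s))$: yes; $r,s$ both even. 3. $(\Gamma(r,s),H(r,s))$: no; $r$ odd, $s$ even. 4. $(\Gamma(s,r),H(s,r))$: no; $r$ even, $s$ odd. 5. $(\Gamma^+(r,s),H^+(r,s))$: no; $r,s$ both even. 6. $(\Gamma_2(r,s),G_2(r,s))$: no; $r,s$ both odd. -/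

import Mathlib

universe u v w z

namespace OG

/-! ### Graph-group pairs, normal quotients -/

section Pairs

variable {V : Type u} {G : Type v} [Group G] [MulAction G V]

/-- `(Γ, G) ∈ OG(4)` with specified orbit `Δ` on ordered pairs: `Γ` is a finite connected simple
graph of valency 4, `G` acts faithfully by automorphisms (that is, `G ≤ Aut Γ`), transitively on
vertices and on edges, and `Δ` is a `G`-orbit on ordered vertex pairs containing exactly one
ordered pair for each edge. The edge `{x, y}` is oriented from `x` to `y` if `(x, y) ∈ Δ`. -/
structure IsOG4 (Γ : SimpleGraph V) (G : Type v) [Group G] [MulAction G V]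
    (Δ : Set (V × V)) : Prop where
  finite : Finite V
  connected : Γ.Connected
  valency : ∀ x, (Γ.neighborSet x).ncard = 4
  faithful : FaithfulSMul G V
  adj_smul : ∀ (g : G) (x y : V), Γ.Adj x y → Γ.Adj (g • x) (g • y)
  vertex_transitive : MulAction.IsPretransitive G V
  edge_transitive : ∀ e ∈ Γ.edgeSet, ∀ e' ∈ Γ.edgeSet, ∃ g : G, e.map (fun x => g • x) = e'
  isOrbit : ∃ p : V × V, Δ = MulAction.orbit G p
  adj_of_mem : ∀ x y, (x, y) ∈ Δ → Γ.Adj x y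
  one_per_edge : ∀ x y, Γ.Adj x y → ((x, y) ∈ Δ ∧ (y, x) ∉ Δ) ∨ ((y, x) ∈ Δ ∧ (x, y) ∉ Δ)

/-- The set of `N`-orbits on vertices. -/
abbrev Orbits (N : Subgroup G) (V : Type u) [MulAction G V] : Type u :=
  MulAction.orbitRel.Quotient N V

/-- The `N`-orbit containing `x`. -/
abbrev orb (N : Subgroup G) (x : V) : Orbits N V := Quotient.mk _ x

/-- The normal quotient `Γ_N`. -/
def normalQuotient (Γ : SimpleGraph V) (N : Subgroup G) : SimpleGraph (Orbits N V) where
  Adj B C := B ≠ C ∧ ∃ x y, Γ.Adj x y ∧ orb N x = B ∧ orb N y = C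
  symm := ⟨fun _ _ ⟨h, x, y, hxy, hx, hy⟩ => ⟨h.symm, y, x, hxy.symm, hy, hx⟩⟩
  loopless := ⟨fun _ h => h.1 rfl⟩

/-- The ordered pairs of `N`-orbits joined by at least one arc of `Δ`. -/
def quotientArcs (Δ : Set (V × V)) (N : Subgroup G) : Set (Orbits N V × Orbits N V) :=
  {p | ∃ x y, (x, y) ∈ Δ ∧ orb N x = p.1 ∧ orb N y = p.2}

/-- `Γ_N` is `G`-oriented: for adjacent `N`-orbits `B`, `C`, all edges between `B` and `C` have
the same orientation. -/
def QuotientOriented (Γ : SimpleGraph V) (Δ : Set (V × V)) (N : Subgroup G) : Prop :=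
  ∀ B C, (normalQuotient Γ N).Adj B C →
    ¬ ((B, C) ∈ quotientArcs Δ N ∧ (C, B) ∈ quotientArcs Δ N)

/-- The graph `Γ` is a cycle. -/
def IsCycleGraph (Γ : SimpleGraph V) : Prop :=
  ∃ n : ℕ, 3 ≤ n ∧ Nonempty (Γ ≃g SimpleGraph.cycleGraph n)

/-- The subgroup of all elements of `G` fixing setwise each `N`-orbit on vertices. -/
def orbitKernel (N : Subgroup G) (V : Type u) [MulAction G V] : Subgroup G where
  carrier := {g | ∀ x : V, orb N (g • x) = orb N x}
  one_mem' := fun x => by rw [one_smul]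
  mul_mem' := fun {a b} ha hb x => by rw [mul_smul]; exact (ha (b • x)).trans (hb x)
  inv_mem' := fun {a} ha x => by
    have h := ha (a⁻¹ • x)
    rw [smul_inv_smul] at h
    exact h.symm

theorem orb_smul {N : Subgroup G} [hN : N.Normal] (g : G) {x y : V} (h : orb N x = orb N y) :
    orb N (g • x) = orb N (g • y) := by
  obtain ⟨n, hn⟩ := Quotient.exact h
  refine Quotient.sound ⟨⟨g * n * g⁻¹, hN.conj_mem n n.2 g⟩, ?_⟩
  have hn' : (n : G) • y = x := hn
  change (g * n * g⁻¹) • g • y = g • x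
  rw [← mul_smul, inv_mul_cancel_right, mul_smul, hn']

instance orbitKernel_normal (N : Subgroup G) [N.Normal] : (orbitKernel N V).Normal where
  conj_mem n hn g x := by
    have h := orb_smul g (hn (g⁻¹ • x))
    rwa [smul_inv_smul, ← mul_smul, ← mul_smul] at h

/-- Independence of the normal quotients `Γ_N` and `Γ_M`: with `K` the intersection of the two
orbit kernels, the normal quotient `Γ_K` is not a cycle. -/
def Independent (Γ : SimpleGraph V) (N M : Subgroup G) : Prop :=
  ¬ IsCycleGraph (normalQuotient Γ (orbitKernel N V ⊓ orbitKernel M V))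

/-- `G ⧸ T` acts on the `T`-orbits by `(g T) • x^T = (g • x)^T`. -/
instance quotientAction (T : Subgroup G) [hT : T.Normal] : MulAction (G ⧸ T) (Orbits T V) where
  smul q B := Quotient.liftOn₂' q B (fun g x => orb T (g • x)) (by
    intro g x g' x' hg hx
    have h1 : orb T (g • x) = orb T (g • x') := orb_smul g (Quotient.sound hx)
    have h2 : orb T (g • x') = orb T (g' • x') := by
      have hm : g⁻¹ * g' ∈ T := QuotientGroup.leftRel_apply.mp hg
      have h3 : orb T ((g⁻¹ * g') • x') = orb T x' := Quotient.sound ⟨⟨_, hm⟩, rfl⟩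
      have h4 := orb_smul g h3
      rw [← mul_smul, mul_inv_cancel_left] at h4
      exact h4.symm
    exact h1.trans h2)
  one_smul B := by
    induction B using Quotient.inductionOn' with
    | h x => exact congrArg (orb T) (one_smul G x)
  mul_smul p q B := by
    induction B using Quotient.inductionOn' with
    | h x =>
      induction p using Quotient.inductionOn' with
      | h g =>
        induction q using Quotient.inductionOn' with
        | h k => exact congrArg (orb T) (mul_smul g k x)

/-- `(Γ, G)` is a normal cover of `(Γ_T, G ⧸ T)`: if `B`, `C` are adjacent `T`-orbits, then each
vertex of `B` is joined to exactly one vertex of `C`. -/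
def IsNormalCover (Γ : SimpleGraph V) (T : Subgroup G) : Prop :=
  ∀ B C, (normalQuotient Γ T).Adj B C → ∀ x, orb T x = B → ∃! y, orb T y = C ∧ Γ.Adj x y

/-- Isomorphism of graph-group pairs, respecting the specified orientations. -/
def PairIso {W : Type w} (Γ : SimpleGraph V) (G : Type v) [Group G] [MulAction G V]
    (Δ : Set (V × V)) (Γ' : SimpleGraph W) (G' : Type z) [Group G'] [MulAction G' W]
    (Δ' : Set (W × W)) : Prop :=
  ∃ (f : Γ ≃g Γ') (φ : G ≃* G'), (∀ (g : G) (x : V), f (g • x) = φ g • f x) ∧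
    ∀ x y, (x, y) ∈ Δ ↔ (f x, f y) ∈ Δ'

end Pairs

/-! ### The explicit families -/

/-- The set `X = ℤ_r × ℤ_s`. -/
abbrev X (r s : ℕ) : Type := ZMod r × ZMod s

/-- The graph `Γ(r,s)`: the vertex `(i, j)` is joined to `(i ± 1, j ± 1)`.
(The clause `p ≠ q` is automatic for `r, s ≥ 2`.) -/
def Gam (r s : ℕ) : SimpleGraph (X r s) where
  Adj p q := p ≠ q ∧ (q.1 = p.1 + 1 ∨ q.1 = p.1 - 1) ∧ (q.2 = p.2 + 1 ∨ q.2 = p.2 - 1)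
  symm := ⟨by
    rintro p q ⟨h, h1, h2⟩
    refine ⟨h.symm, ?_, ?_⟩
    · rcases h1 with h1 | h1
      · right; rw [h1]; ring
      · left; rw [h1]; ring
    · rcases h2 with h2 | h2
      · right; rw [h2]; ring
      · left; rw [h2]; ring⟩
  loopless := ⟨fun _ h => h.1 rfl⟩

/-- The set `X⁺` of pairs `(i, j)` with `i`, `j` of the same parity (used for `r`, `s` even). -/
def Xplus (r s : ℕ) : Set (X r s) := {p | Even p.1.val ↔ Even p.2.val}

/-- The graph `Γ⁺(r,s)`, the subgraph of `Γ(r,s)` induced on `X⁺`. -/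
def GamPlus (r s : ℕ) : SimpleGraph (Xplus r s) := (Gam r s).induce (Xplus r s)

/-- `μ : (i, j) ↦ (i + 1, j)`. -/
def mu (r s : ℕ) : Equiv.Perm (X r s) := (Equiv.addRight 1).prodCongr (Equiv.refl _)

/-- `ν : (i, j) ↦ (i, j + 1)`. -/
def nu (r s : ℕ) : Equiv.Perm (X r s) := (Equiv.refl _).prodCongr (Equiv.addRight 1)

/-- `σ : (i, j) ↦ (-i, j)`. -/
def sigma (r s : ℕ) : Equiv.Perm (X r s) := (Equiv.neg _).prodCongr (Equiv.refl _)

/-- `τ : (i, j) ↦ (-i, -j)`. -/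
def tau (r s : ℕ) : Equiv.Perm (X r s) := (Equiv.neg _).prodCongr (Equiv.neg _)

/-- `G(r,s) = ⟨μ, ν, σ⟩`. -/
def Grp (r s : ℕ) : Subgroup (Equiv.Perm (X r s)) :=
  Subgroup.closure {mu r s, nu r s, sigma r s}

/-- `H(r,s) = ⟨μ, σν, τ⟩` (used for `s` even). Here and below a word such as `σμν` means: first
`σ`, then `μ`, then `ν`; in `Equiv.Perm` this is the product in reverse order. -/
def Hrp (r s : ℕ) : Subgroup (Equiv.Perm (X r s)) :=
  Subgroup.closure {mu r s, nu r s * sigma r s, tau r s}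

/-- The restrictions to `X⁺` of those elements of `S` that leave `X⁺` invariant. -/
def restrictions {r s : ℕ} (S : Set (Equiv.Perm (X r s))) : Set (Equiv.Perm (Xplus r s)) :=
  {g | ∃ h ∈ S, ∀ p : Xplus r s, (g p : X r s) = h p}

/-- `G⁺(r,s) = ⟨μ², μν, σ⟩`, acting on `X⁺` (used for `r`, `s` even). -/
def GrpPlus (r s : ℕ) : Subgroup (Equiv.Perm (Xplus r s)) :=
  Subgroup.closure (restrictions {mu r s ^ 2, nu r s * mu r s, sigma r s})

/-- `H⁺(r,s) = ⟨μ², σμν, τ⟩`, acting on `X⁺` (used for `r`, `s` even). -/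
def HrpPlus (r s : ℕ) : Subgroup (Equiv.Perm (Xplus r s)) :=
  Subgroup.closure (restrictions {mu r s ^ 2, nu r s * mu r s * sigma r s, tau r s})

/-- The orientation `(i, j) → (i ± 1, j + 1)`. -/
def arcsG (r s : ℕ) : Set (X r s × X r s) :=
  {a | (a.2.1 = a.1.1 + 1 ∨ a.2.1 = a.1.1 - 1) ∧ a.2.2 = a.1.2 + 1}

/-- The sign `(-1)^j` for `j ∈ ℤ_s` (used for `s` even). -/
def sgn {s : ℕ} (j : ZMod s) : ZMod s := (-1) ^ j.val

/-- The orientation `(i, j) → (i + 1, j + (-1)^j)`, `(i, j) → (i - 1, j - (-1)^j)`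
(used for `s` even). -/
def arcsH (r s : ℕ) : Set (X r s × X r s) :=
  {a | a.2 = (a.1.1 + 1, a.1.2 + sgn a.1.2) ∨ a.2 = (a.1.1 - 1, a.1.2 - sgn a.1.2)}

/-- Restriction of an orientation to `X⁺`. -/
def arcsPlus {r s : ℕ} (Δ : Set (X r s × X r s)) : Set (Xplus r s × Xplus r s) :=
  {a | ((a.1 : X r s), (a.2 : X r s)) ∈ Δ}

/-- The standard double cover of a graph. -/
def doubleCover {V : Type u} (Γ : SimpleGraph V) : SimpleGraph (V × ZMod 2) where
  Adj p q := p.2 ≠ q.2 ∧ Γ.Adj p.1 q.1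
  symm := ⟨fun _ _ h => ⟨h.1.symm, h.2.symm⟩⟩
  loopless := ⟨fun _ h => h.1 rfl⟩

/-- The graph `Γ₂(r,s)`. -/
def Gam2 (r s : ℕ) : SimpleGraph (X r s × ZMod 2) := doubleCover (Gam r s)

/-- `σ : (i, j)_δ ↦ (i, -j)_{δ+1}`. -/
def sigma2 (r s : ℕ) : Equiv.Perm (X r s × ZMod 2) :=
  ((Equiv.refl _).prodCongr (Equiv.neg _)).prodCongr (Equiv.addRight 1)

/-- `G₂(r,s) = ⟨μ, ν, σ, τ⟩`, where `μ`, `ν`, `τ` act on the first component of `X × ℤ₂` as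
before and `σ` is `sigma2`. -/
def Grp2 (r s : ℕ) : Subgroup (Equiv.Perm (X r s × ZMod 2)) :=
  Subgroup.closure {(mu r s).prodCongr (Equiv.refl _), (nu r s).prodCongr (Equiv.refl _),
    sigma2 r s, (tau r s).prodCongr (Equiv.refl _)}

/-- The orientation `(i, j)_δ → (i + 1, j + (-1)^δ)_{δ+1}`,
`(i, j)_δ → (i - 1, j - (-1)^δ)_{δ+1}`. -/
def arcs2 (r s : ℕ) : Set ((X r s × ZMod 2) × (X r s × ZMod 2)) :=
  {a | a.2 = ((a.1.1.1 + 1, a.1.1.2 + (-1) ^ a.1.2.val), a.1.2 + 1) ∨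
    a.2 = ((a.1.1.1 - 1, a.1.1.2 - (-1) ^ a.1.2.val), a.1.2 + 1)}

/-- The table of the classification: `TableLine r s Γ G Δ b` says that the (oriented) pair
`(Γ, G)` is as in one of the six lines, whose parity conditions hold and whose entry in the
column `Γ_M oriented?` is `b`. -/
inductive TableLine (r s : ℕ) {V : Type u} (Γ : SimpleGraph V) (G : Type v) [Group G]
    [MulAction G V] (Δ : Set (V × V)) : Bool → Prop
  | line1 : (Odd r ∨ Odd s) →
      PairIso Γ G Δ (Gam r s) (Grp r s) (arcsG r s) → TableLine r s Γ G Δ true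
  | line2 : Even r → Even s →
      PairIso Γ G Δ (GamPlus r s) (GrpPlus r s) (arcsPlus (arcsG r s)) → TableLine r s Γ G Δ true
  | line3 : Odd r → Even s →
      PairIso Γ G Δ (Gam r s) (Hrp r s) (arcsH r s) → TableLine r s Γ G Δ false
  | line4 : Even r → Odd s →
      PairIso Γ G Δ (Gam s r) (Hrp s r) (arcsH s r) → TableLine r s Γ G Δ false
  | line5 : Even r → Even s →
      PairIso Γ G Δ (GamPlus r s) (HrpPlus r s) (arcsPlus (arcsH r s)) → TableLine r s Γ G Δ false
  | line6 : Odd r → Odd s →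
      PairIso Γ G Δ (Gam2 r s) (Grp2 r s) (arcs2 r s) → TableLine r s Γ G Δ false

end OG

/-! # Quadrivalent oriented graphs with independent cyclic normal quotients -/

namespace OG

/-! ### Cyclic labels of the vertices, and the oriented/bidirectional dichotomy -/

section Labels

variable {V : Type u} {G : Type v} [Group G] [MulAction G V] {Γ : SimpleGraph V} {Δ : Set (V × V)}

/-! The cycles `Γ_N` and `Γ_M` give labels `a : V → ZMod r` and `b : V → ZMod s` that change by `±1`
along every edge and on which each element of `G` acts as a rotation or a reflection. The fibres of
`a` and `b` are the orbits of `N` and `M`, and `T` is the subgroup fixing all labels of both kinds.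

A label obeys a dichotomy (`CycleLabel.oriented_or_bidirectional`). If some vertex stabilizer
contains a reflection of the label, every vertex has out-neighbours and in-neighbours on both sides;
otherwise all arcs run the same way round the cycle. If both labels were oriented, all arcs would
change `(a, b)` by one and the same vector `(±1, ±1)`, and the quotient by `T` would be a cycle
(`isCycleGraph_of_diagonal`), against independence. Hence at least one label is bidirectional, which
is (a). By valency 4, a bidirectional label together with the direction of the arc separates the
neighbours of a vertex. So an element fixing a vertex and all values of this label is trivial, and
the vertex stabilizer consists of 1 and one reflection.

Let `a` be bidirectional. If `b` is too, the arcs out of `x` lead in the directions `±(1, (-1)^(e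
x))` for some slope `e x` in `ZMod 2`. Each group element shifts `e` by a constant, so by
arc-transitivity `e` is preserved along all arcs or changed along all of them. The first case makes
the quotient by `T` a cycle again, so `e` alternates (`IsSlope.flip`). It follows, also when `b` is
oriented, that the four neighbours of a vertex have distinct label pairs
(`label_injective_on_neighbors`). This is the normal cover property, and it makes the quotient pair
a member of the family, as (b) requires.

For (c), work in the quotient, where only 1 fixes all labels. Vertices with equal label pairs, and
equal slopes if `b` is bidirectional, then coincide, so the labels are coordinates. All four steps
`(±1, ±1)` occur at each vertex. The label pairs therefore fill `X r s` if `r` or `s` is odd and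
`Xplus r s` if both are even. An alternating slope is, up to normalization, the parity of a label of
even modulus; if both moduli are odd it is an independent coordinate, whence the double cover. The
group is then forced by rigidity (`pairIso_of_labels`): it and the model group are both transitive
with a nontrivial point stabilizer, inside a group whose point stabilizers have order at most 2. -/

theorem connected_induction (h : Γ.Connected) {P : V → Prop} (x : V) (hx : P x)
    (step : ∀ v w, Γ.Adj v w → P v → P w) (v : V) : P v := by
  obtain ⟨p⟩ := h.preconnected x v
  induction p with
  | nil => exact hx
  | cons hadj _ ih => exact ih (step _ _ hadj hx)

theorem two_ne_zero_zmod {n : ℕ} (hn : 3 ≤ n) : (2 : ZMod n) ≠ 0 := by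
  intro h
  have h' : ((2 : ℕ) : ZMod n) = 0 := by exact_mod_cast h
  have := Nat.le_of_dvd (by norm_num) ((ZMod.natCast_eq_zero_iff 2 n).mp h')
  omega

theorem one_ne_zero_zmod {n : ℕ} (hn : 3 ≤ n) : (1 : ZMod n) ≠ 0 := fun h =>
  two_ne_zero_zmod hn (by linear_combination 2 * h)

namespace IsOG4

theorem arc_smul (hΓ : IsOG4 Γ G Δ) (g : G) {x y : V} (h : (x, y) ∈ Δ) :
    (g • x, g • y) ∈ Δ := by
  obtain ⟨p, rfl⟩ := hΓ.isOrbit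
  exact MulAction.mem_orbit_of_mem_orbit g h

theorem exists_smul_arc (hΓ : IsOG4 Γ G Δ) {x y x' y' : V} (h : (x, y) ∈ Δ)
    (h' : (x', y') ∈ Δ) : ∃ g : G, g • x = x' ∧ g • y = y' := by
  obtain ⟨p, rfl⟩ := hΓ.isOrbit
  obtain ⟨g, hg⟩ := h
  obtain ⟨g', hg'⟩ := h'
  have hg : g • p = (x, y) := hg
  have hg' : g' • p = (x', y') := hg'
  have : (g' * g⁻¹) • (x, y) = (x', y') := by rw [← hg, mul_smul, inv_smul_smul, hg']
  exact ⟨g' * g⁻¹, congrArg Prod.fst this, congrArg Prod.snd this⟩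

theorem arc_asymm (hΓ : IsOG4 Γ G Δ) {x y : V} (h : (x, y) ∈ Δ) : (y, x) ∉ Δ := by
  have := hΓ.one_per_edge x y (hΓ.adj_of_mem _ _ h)
  tauto

theorem adj_iff (hΓ : IsOG4 Γ G Δ) {x y : V} : Γ.Adj x y ↔ (x, y) ∈ Δ ∨ (y, x) ∈ Δ := by
  constructor
  · intro h
    have := hΓ.one_per_edge x y h
    tauto
  · rintro (h | h)
    · exact hΓ.adj_of_mem _ _ h
    · exact (hΓ.adj_of_mem _ _ h).symm

theorem exists_smul_eq (hΓ : IsOG4 Γ G Δ) (x y : V) : ∃ g : G, g • x = y :=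
  hΓ.vertex_transitive.exists_smul_eq x y

theorem exists_out (hΓ : IsOG4 Γ G Δ) (x : V) : ∃ y, (x, y) ∈ Δ := by
  obtain ⟨p, hp⟩ := hΓ.isOrbit
  have h : (p.1, p.2) ∈ Δ := by rw [hp]; exact MulAction.mem_orbit_self p
  obtain ⟨g, hg⟩ := hΓ.exists_smul_eq p.1 x
  exact ⟨g • p.2, hg ▸ hΓ.arc_smul g h⟩

theorem exists_in (hΓ : IsOG4 Γ G Δ) (x : V) : ∃ y, (y, x) ∈ Δ := by
  obtain ⟨p, hp⟩ := hΓ.isOrbit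
  have h : (p.1, p.2) ∈ Δ := by rw [hp]; exact MulAction.mem_orbit_self p
  obtain ⟨g, hg⟩ := hΓ.exists_smul_eq p.2 x
  exact ⟨g • p.1, hg ▸ hΓ.arc_smul g h⟩

theorem eq_one_of_smul_eq (hΓ : IsOG4 Γ G Δ) {g : G} (h : ∀ x : V, g • x = x) : g = 1 := by
  have := hΓ.faithful
  exact FaithfulSMul.eq_of_smul_eq_smul (α := V) fun x => by rw [h, one_smul]

end IsOG4

/-- The map `p` acts on the labels `a` as a rotation or a reflection. -/
def ActsDihedrally {W : Type w} {n : ℕ} (a : W → ZMod n) (p : W → W) : Prop :=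
  (∃ c, ∀ x, a (p x) = a x + c) ∨ ∃ c, ∀ x, a (p x) = c - a x

/-- A labelling of the vertices by `ℤ_n` which projects `Γ` onto an `n`-cycle on which `G` acts. -/
structure CycleLabel (Γ : SimpleGraph V) (G : Type v) [Group G] [MulAction G V] {n : ℕ}
    (a : V → ZMod n) : Prop where
  adj : ∀ x y, Γ.Adj x y → a y = a x + 1 ∨ a y = a x - 1
  up : ∀ x, ∃ y, Γ.Adj x y ∧ a y = a x + 1
  down : ∀ x, ∃ y, Γ.Adj x y ∧ a y = a x - 1
  dihedral : ∀ g : G, ActsDihedrally a fun x => g • x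

/-- All arcs change the label by the same sign. -/
def Oriented {n : ℕ} (Δ : Set (V × V)) (a : V → ZMod n) : Prop :=
  (∀ x y, (x, y) ∈ Δ → a y = a x + 1) ∨ ∀ x y, (x, y) ∈ Δ → a y = a x - 1

/-- Every vertex has out-neighbours and in-neighbours on both sides. -/
structure Bidirectional {n : ℕ} (Δ : Set (V × V)) (a : V → ZMod n) : Prop where
  out_up : ∀ x, ∃ y, (x, y) ∈ Δ ∧ a y = a x + 1
  out_down : ∀ x, ∃ y, (x, y) ∈ Δ ∧ a y = a x - 1
  in_up : ∀ x, ∃ y, (y, x) ∈ Δ ∧ a y = a x + 1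
  in_down : ∀ x, ∃ y, (y, x) ∈ Δ ∧ a y = a x - 1

namespace CycleLabel

variable {n : ℕ} {a : V → ZMod n}

theorem add_const (ha : CycleLabel Γ G a) (c : ZMod n) : CycleLabel Γ G fun x => a x + c where
  adj x y h := by rcases ha.adj x y h with h | h <;> simp only [h] <;> ring_nf <;> simp
  up x := by obtain ⟨y, h, h'⟩ := ha.up x; exact ⟨y, h, by rw [h']; ring⟩
  down x := by obtain ⟨y, h, h'⟩ := ha.down x; exact ⟨y, h, by rw [h']; ring⟩
  dihedral g := by
    rcases ha.dihedral g with ⟨d, h⟩ | ⟨d, h⟩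
    · exact .inl ⟨d, fun x => by simp only [h]; ring⟩
    · exact .inr ⟨d + 2 * c, fun x => by simp only [h]; ring⟩

theorem neg (ha : CycleLabel Γ G a) : CycleLabel Γ G fun x => -a x where
  adj x y h := by
    rcases ha.adj x y h with h | h
    · right; rw [h]; ring
    · left; rw [h]; ring
  up x := by obtain ⟨y, h, h'⟩ := ha.down x; exact ⟨y, h, by rw [h']; ring⟩
  down x := by obtain ⟨y, h, h'⟩ := ha.up x; exact ⟨y, h, by rw [h']; ring⟩
  dihedral g := by
    rcases ha.dihedral g with ⟨d, h⟩ | ⟨d, h⟩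
    · exact .inl ⟨-d, fun x => by simp only [h]; ring⟩
    · exact .inr ⟨-d, fun x => by simp only [h]; ring⟩

theorem fix_or_reflect (ha : CycleLabel Γ G a) {g : G} {x : V} (h : a (g • x) = a x) :
    (∀ v, a (g • v) = a v) ∨ ∀ v, a (g • v) = 2 * a x - a v := by
  rcases ha.dihedral g with ⟨c, hc⟩ | ⟨c, hc⟩
  · left; intro v
    have hx := hc x
    have hv := hc v
    simp only at hx hv
    linear_combination hv + h - hx
  · right; intro v
    have hx := hc x
    have hv := hc v
    simp only at hx hv
    linear_combination hv + h - hx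

/-- A reflection fixing `x` maps an out-neighbour of `x` on one side to one on the other, and
likewise for in-neighbours. Vertex-transitivity carries this to all vertices, since a dihedral map
either keeps or exchanges the two sides. -/
theorem bidirectional_of_reflect (hΓ : IsOG4 Γ G Δ) (ha : CycleLabel Γ G a) {g : G} {x : V}
    (hx : g • x = x) (hg : ∀ v, a (g • v) = 2 * a x - a v) : Bidirectional Δ a := by
  have hout : (∃ y, (x, y) ∈ Δ ∧ a y = a x + 1) ∧ ∃ y, (x, y) ∈ Δ ∧ a y = a x - 1 := by
    obtain ⟨y, hy⟩ := hΓ.exists_out x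
    have hy' : (x, g • y) ∈ Δ := by simpa only [hx] using hΓ.arc_smul g hy
    rcases ha.adj x y (hΓ.adj_of_mem _ _ hy) with h | h
    · exact ⟨⟨y, hy, h⟩, _, hy', by rw [hg, h]; ring⟩
    · exact ⟨⟨_, hy', by rw [hg, h]; ring⟩, y, hy, h⟩
  have hin : (∃ y, (y, x) ∈ Δ ∧ a y = a x + 1) ∧ ∃ y, (y, x) ∈ Δ ∧ a y = a x - 1 := by
    obtain ⟨y, hy⟩ := hΓ.exists_in x
    have hy' : (g • y, x) ∈ Δ := by simpa only [hx] using hΓ.arc_smul g hy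
    rcases ha.adj x y (hΓ.adj_of_mem _ _ hy).symm with h | h
    · exact ⟨⟨y, hy, h⟩, _, hy', by rw [hg, h]; ring⟩
    · exact ⟨⟨_, hy', by rw [hg, h]; ring⟩, y, hy, h⟩
  obtain ⟨⟨y₁, hy₁, e₁⟩, y₂, hy₂, e₂⟩ := hout
  obtain ⟨⟨z₁, hz₁, f₁⟩, z₂, hz₂, f₂⟩ := hin
  have key : ∀ v, ((∃ y, (v, y) ∈ Δ ∧ a y = a v + 1) ∧ ∃ y, (v, y) ∈ Δ ∧ a y = a v - 1) ∧
      (∃ y, (y, v) ∈ Δ ∧ a y = a v + 1) ∧ ∃ y, (y, v) ∈ Δ ∧ a y = a v - 1 := by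
    intro v
    obtain ⟨k, rfl⟩ := hΓ.exists_smul_eq x v
    rcases ha.dihedral k with ⟨c, hc⟩ | ⟨c, hc⟩ <;> simp only at hc
    · exact ⟨⟨⟨_, hΓ.arc_smul k hy₁, by rw [hc, hc, e₁]; ring⟩,
        ⟨_, hΓ.arc_smul k hy₂, by rw [hc, hc, e₂]; ring⟩⟩,
        ⟨_, hΓ.arc_smul k hz₁, by rw [hc, hc, f₁]; ring⟩,
        ⟨_, hΓ.arc_smul k hz₂, by rw [hc, hc, f₂]; ring⟩⟩
    · exact ⟨⟨⟨_, hΓ.arc_smul k hy₂, by rw [hc, hc, e₂]; ring⟩,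
        ⟨_, hΓ.arc_smul k hy₁, by rw [hc, hc, e₁]; ring⟩⟩,
        ⟨_, hΓ.arc_smul k hz₂, by rw [hc, hc, f₂]; ring⟩,
        ⟨_, hΓ.arc_smul k hz₁, by rw [hc, hc, f₁]; ring⟩⟩
  exact ⟨fun v => (key v).1.1, fun v => (key v).1.2, fun v => (key v).2.1, fun v => (key v).2.2⟩

/-- If no vertex stabilizer reflects the label, stabilizers fix all labels. A stabilizer permutes
the out-neighbours transitively, because `Δ` is a single orbit, so these lie on one side; the same
goes for the in-neighbours. As a vertex has neighbours on both sides, the in-neighbours lie opposite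
the out-neighbours, and connectedness spreads one direction over the whole graph. -/
theorem oriented_or_bidirectional (hΓ : IsOG4 Γ G Δ) (hn : 3 ≤ n) (ha : CycleLabel Γ G a) :
    Oriented Δ a ∨ Bidirectional Δ a := by
  have h2 := two_ne_zero_zmod hn
  by_cases hrefl : ∃ (g : G) (x : V), g • x = x ∧ ∀ v, a (g • v) = 2 * a x - a v
  · obtain ⟨g, x, hx, hg⟩ := hrefl
    exact .inr (ha.bidirectional_of_reflect hΓ hx hg)
  left
  have hfix : ∀ (g : G) (x : V), g • x = x → ∀ v, a (g • v) = a v := by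
    intro g x hx
    rcases ha.fix_or_reflect (show a (g • x) = a x by rw [hx]) with h | h
    · exact h
    · exact absurd ⟨g, x, hx, h⟩ hrefl
  have hout : ∀ x y y', (x, y) ∈ Δ → (x, y') ∈ Δ → a y = a y' := by
    intro x y y' h h'
    obtain ⟨g, hg, rfl⟩ := hΓ.exists_smul_arc h h'
    exact (hfix g x hg y).symm
  have hin : ∀ x y y', (y, x) ∈ Δ → (y', x) ∈ Δ → a y = a y' := by
    intro x y y' h h'
    obtain ⟨g, rfl, hg⟩ := hΓ.exists_smul_arc h h'
    exact (hfix g x hg y).symm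
  -- all arcs at a vertex run in the same direction
  have hloc : ∀ x, ((∀ y, (x, y) ∈ Δ → a y = a x + 1) ∧ ∀ y, (y, x) ∈ Δ → a y = a x - 1) ∨
      (∀ y, (x, y) ∈ Δ → a y = a x - 1) ∧ ∀ y, (y, x) ∈ Δ → a y = a x + 1 := by
    intro x
    obtain ⟨y, hy⟩ := hΓ.exists_out x
    obtain ⟨u, hu, eu⟩ := ha.up x
    obtain ⟨d, hd, ed⟩ := ha.down x
    rw [hΓ.adj_iff] at hu hd
    rcases ha.adj x y (hΓ.adj_of_mem _ _ hy) with h | h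
    · left
      have hd' : (d, x) ∈ Δ := by
        rcases hd with hd | hd
        · have := hout x y d hy hd
          exact absurd (by linear_combination h.symm + ed + this) h2
        · exact hd
      exact ⟨fun z hz => (hout x z y hz hy).trans h, fun z hz => (hin x z d hz hd').trans ed⟩
    · right
      have hu' : (u, x) ∈ Δ := by
        rcases hu with hu | hu
        · have := hout x y u hy hu
          exact absurd (by linear_combination - this + h - eu) h2
        · exact hu
      exact ⟨fun z hz => (hout x z y hz hy).trans h, fun z hz => (hin x z u hz hu').trans eu⟩
  obtain ⟨x₀⟩ := hΓ.connected.nonempty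
  rcases hloc x₀ with h₀ | h₀
  · left
    have := connected_induction hΓ.connected
      (P := fun x => (∀ y, (x, y) ∈ Δ → a y = a x + 1) ∧ ∀ y, (y, x) ∈ Δ → a y = a x - 1) x₀ h₀ (by
        rintro v w hvw ⟨h1, h1'⟩
        rcases hloc w with hw | ⟨hw, hw'⟩
        · exact hw
        · rcases hΓ.adj_iff.mp hvw with h | h
          · exact absurd (by linear_combination -(hw' v h) - h1 w h) h2
          · exact absurd (by linear_combination (hw v h) + h1' w h) h2)
    exact fun x y h => (this x).1 y h
  · right
    have := connected_induction hΓ.connected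
      (P := fun x => (∀ y, (x, y) ∈ Δ → a y = a x - 1) ∧ ∀ y, (y, x) ∈ Δ → a y = a x + 1) x₀ h₀ (by
        rintro v w hvw ⟨h1, h1'⟩
        rcases hloc w with ⟨hw, hw'⟩ | hw
        · rcases hΓ.adj_iff.mp hvw with h | h
          · exact absurd (by linear_combination (hw' v h) + h1 w h) h2
          · exact absurd (by linear_combination -(hw v h) - h1' w h) h2
        · exact hw)
    exact fun x y h => (this x).1 y h

end CycleLabel

theorem Bidirectional.not_oriented [Nonempty V] {n : ℕ} {a : V → ZMod n} (hn : 3 ≤ n)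
    (h : Bidirectional Δ a) : ¬ Oriented Δ a := by
  have h2 := two_ne_zero_zmod hn
  obtain ⟨x⟩ := ‹Nonempty V›
  obtain ⟨y, hy, ey⟩ := h.out_up x
  obtain ⟨z, hz, ez⟩ := h.out_down x
  rintro (ho | ho)
  · exact h2 (by linear_combination ez - ho x z hz)
  · exact h2 (by linear_combination -ey + ho x y hy)

/-- By the dichotomy, a label that is not oriented has, next to any vertex, both an out-neighbour
and an in-neighbour on the upper side, hence arcs both ways between two adjacent orbits. -/
theorem quotientOriented_iff (hΓ : IsOG4 Γ G Δ) {n : ℕ} (hn : 3 ≤ n) {a : V → ZMod n}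
    (ha : CycleLabel Γ G a) {N : Subgroup G} (haN : ∀ x y, a x = a y ↔ orb N x = orb N y) :
    QuotientOriented Γ Δ N ↔ Oriented Δ a := by
  have h2 := two_ne_zero_zmod hn
  constructor
  · intro h
    rcases ha.oriented_or_bidirectional hΓ hn with ho | hb
    · exact ho
    obtain ⟨x⟩ := hΓ.connected.nonempty
    obtain ⟨y, hy, ey⟩ := hb.out_up x
    obtain ⟨z, hz, ez⟩ := hb.in_up x
    have hne : orb N x ≠ orb N y := by
      rw [Ne, ← haN, ey]
      intro h'
      exact one_ne_zero_zmod hn (by linear_combination -h')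
    refine absurd ⟨⟨x, y, hy, rfl, rfl⟩, ⟨z, x, hz, ?_, rfl⟩⟩
      (h (orb N x) (orb N y) ⟨hne, x, y, hΓ.adj_of_mem _ _ hy, rfl, rfl⟩)
    rw [← haN, ez, ey]
  · rintro h B C - ⟨⟨x, y, hxy, hx, hy⟩, ⟨y', x', hyx, hy', hx'⟩⟩
    simp only at hx hy hx' hy'
    have e1 : a x = a x' := (haN _ _).mpr (hx.trans hx'.symm)
    have e2 : a y = a y' := (haN _ _).mpr (hy.trans hy'.symm)
    rcases h with h | h
    · exact h2 (by linear_combination -(h _ _ hxy) - h _ _ hyx - e1 + e2)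
    · exact h2 (by linear_combination (h _ _ hxy) + h _ _ hyx + e1 - e2)

/-! ### Labels from cyclic quotients and conversely -/

theorem cycleGraph_adj_iff_finEquiv {n : ℕ} [NeZero n] (hn : 3 ≤ n) (i j : Fin n) :
    (SimpleGraph.cycleGraph n).Adj i j ↔
      ZMod.finEquiv n j = ZMod.finEquiv n i + 1 ∨ ZMod.finEquiv n j = ZMod.finEquiv n i - 1 := by
  obtain ⟨m, rfl⟩ : ∃ m, n = m + 2 := ⟨n - 2, by omega⟩
  rw [SimpleGraph.cycleGraph_adj, ← (ZMod.finEquiv (m + 2)).injective.eq_iff (a := i - j),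
    ← (ZMod.finEquiv (m + 2)).injective.eq_iff (a := j - i), map_sub, map_sub, map_one]
  constructor
  · rintro (h | h)
    · right; linear_combination -h
    · left; linear_combination h
  · rintro (h | h)
    · right; linear_combination h
    · left; linear_combination -h

/-- Follow a walk along which the label always rises by 1; it meets every label. Its image moves by
`±1` at each step and can never turn back, since labels two steps apart differ by `2 ≠ 0` and `p`
respects inequality of labels. So the first step decides between rotation and reflection. -/
theorem actsDihedrally_of_adj {n : ℕ} (hn : 3 ≤ n) {a : V → ZMod n}
    (adj : ∀ x y, Γ.Adj x y → a y = a x + 1 ∨ a y = a x - 1)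
    (up : ∀ x, ∃ y, Γ.Adj x y ∧ a y = a x + 1) [Nonempty V] {p : V → V}
    (hp : ∀ x y, Γ.Adj x y → Γ.Adj (p x) (p y)) (hpa : ∀ x y, a (p x) = a (p y) ↔ a x = a y) :
    ActsDihedrally a p := by
  have : NeZero n := ⟨by omega⟩
  have h2 := two_ne_zero_zmod hn
  obtain ⟨x₀⟩ := ‹Nonempty V›
  choose f hf ef using up
  have hiter : ∀ k : ℕ, a (f^[k] x₀) = a x₀ + k := by
    intro k
    induction k with
    | zero => simp
    | succ k ih => rw [Function.iterate_succ_apply', ef, ih]; push_cast; ring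
  have hsurj : ∀ v, ∃ k : ℕ, a v = a (f^[k] x₀) := fun v =>
    ⟨(a v - a x₀).val, by rw [hiter, ZMod.natCast_zmod_val]; ring⟩
  have hstep : ∀ x, a (p (f x)) = a (p x) + 1 ∨ a (p (f x)) = a (p x) - 1 := fun x =>
    adj _ _ (hp _ _ (hf x))
  have hne : ∀ x, a (p (f (f x))) ≠ a (p x) := fun x h => by
    rw [hpa, ef, ef] at h
    exact h2 (by linear_combination h)
  rcases hstep x₀ with h₀ | h₀
  · left
    have key : ∀ k : ℕ, a (p (f^[k + 1] x₀)) = a (p (f^[k] x₀)) + 1 := by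
      intro k
      induction k with
      | zero => exact h₀
      | succ k ih =>
        have h := hne (f^[k] x₀)
        have h' := hstep (f^[k + 1] x₀)
        simp only [Function.iterate_succ_apply'] at h h' ih ⊢
        rcases h' with h' | h'
        · exact h'
        · exact absurd (by rw [h', ih]; ring) h
    have key' : ∀ k : ℕ, a (p (f^[k] x₀)) = a (p x₀) + k := by
      intro k
      induction k with
      | zero => simp
      | succ k ih => rw [key, ih]; push_cast; ring
    refine ⟨a (p x₀) - a x₀, fun v => ?_⟩
    obtain ⟨k, hk⟩ := hsurj v
    rw [(hpa _ _).mpr hk, key', hk, hiter]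
    ring
  · right
    have key : ∀ k : ℕ, a (p (f^[k + 1] x₀)) = a (p (f^[k] x₀)) - 1 := by
      intro k
      induction k with
      | zero => exact h₀
      | succ k ih =>
        have h := hne (f^[k] x₀)
        have h' := hstep (f^[k + 1] x₀)
        simp only [Function.iterate_succ_apply'] at h h' ih ⊢
        rcases h' with h' | h'
        · exact absurd (by rw [h', ih]; ring) h
        · exact h'
    have key' : ∀ k : ℕ, a (p (f^[k] x₀)) = a (p x₀) - k := by
      intro k
      induction k with
      | zero => simp
      | succ k ih => rw [key, ih]; push_cast; ring
    refine ⟨a (p x₀) + a x₀, fun v => ?_⟩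
    obtain ⟨k, hk⟩ := hsurj v
    rw [(hpa _ _).mpr hk, key', hk, hiter]
    ring

theorem exists_smul_of_orb_eq {N : Subgroup G} {x y : V} (h : orb N x = orb N y) :
    ∃ g ∈ N, g • x = y := by
  obtain ⟨g, hg⟩ := Quotient.exact h.symm
  exact ⟨g, g.2, hg⟩

theorem orb_smul_of_mem {N : Subgroup G} {g : G} (hg : g ∈ N) (x : V) :
    orb N (g • x) = orb N x :=
  Quotient.sound ⟨⟨g, hg⟩, rfl⟩

theorem exists_cycleLabel (hΓ : IsOG4 Γ G Δ) (N : Subgroup G) [N.Normal] {n : ℕ} (hn : 3 ≤ n)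
    (hN : Nonempty (normalQuotient Γ N ≃g SimpleGraph.cycleGraph n)) :
    ∃ a : V → ZMod n, CycleLabel Γ G a ∧ ∀ x y, a x = a y ↔ orb N x = orb N y := by
  obtain ⟨f⟩ := hN
  have : NeZero n := ⟨by omega⟩
  have := hΓ.connected.nonempty
  let a : V → ZMod n := fun x => ZMod.finEquiv n (f (orb N x))
  have haN : ∀ x y, a x = a y ↔ orb N x = orb N y := fun x y => by
    simp only [a, EmbeddingLike.apply_eq_iff_eq]
  have hadj : ∀ B C, (normalQuotient Γ N).Adj B C ↔
      ZMod.finEquiv n (f C) = ZMod.finEquiv n (f B) + 1 ∨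
      ZMod.finEquiv n (f C) = ZMod.finEquiv n (f B) - 1 := fun B C => by
    rw [← f.map_adj_iff, cycleGraph_adj_iff_finEquiv hn]
  have hlift : ∀ x C, (normalQuotient Γ N).Adj (orb N x) C → ∃ y, Γ.Adj x y ∧ orb N y = C := by
    rintro x C ⟨-, x', y', h, hx', hy'⟩
    obtain ⟨g, hg, rfl⟩ := exists_smul_of_orb_eq hx'
    exact ⟨g • y', hΓ.adj_smul g _ _ h, (orb_smul_of_mem hg y').trans hy'⟩
  have hreal : ∀ x (c : ZMod n), (c = a x + 1 ∨ c = a x - 1) → ∃ y, Γ.Adj x y ∧ a y = c := by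
    intro x c hc
    obtain ⟨y, hy, e⟩ := hlift x (f.symm ((ZMod.finEquiv n).symm c)) ((hadj _ _).mpr (by
      simpa using hc))
    exact ⟨y, hy, by simp only [a, e]; simp⟩
  have up : ∀ x, ∃ y, Γ.Adj x y ∧ a y = a x + 1 := fun x => hreal x _ (.inl rfl)
  -- No edge lies inside an `N`-orbit: some edge does not, and `G` permutes both the arcs,
  -- transitively, and the `N`-orbits.
  have hne : ∀ x y, (x, y) ∈ Δ → orb N x ≠ orb N y := by
    obtain ⟨x₀⟩ := hΓ.connected.nonempty
    obtain ⟨y₀, h₀, e₀⟩ := up x₀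
    have hne₀ : orb N x₀ ≠ orb N y₀ := by
      rw [Ne, ← haN, e₀]
      intro h
      exact one_ne_zero_zmod hn (by linear_combination -h)
    intro x y hxy h
    rcases hΓ.adj_iff.mp h₀ with h' | h'
    · obtain ⟨g, rfl, rfl⟩ := hΓ.exists_smul_arc hxy h'
      exact hne₀ (orb_smul g h)
    · obtain ⟨g, rfl, rfl⟩ := hΓ.exists_smul_arc hxy h'
      exact hne₀ (orb_smul g h).symm
  have adj : ∀ x y, Γ.Adj x y → a y = a x + 1 ∨ a y = a x - 1 := by
    intro x y h
    refine (hadj (orb N x) (orb N y)).mp ⟨?_, x, y, h, rfl, rfl⟩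
    rcases hΓ.adj_iff.mp h with h' | h'
    · exact hne _ _ h'
    · exact (hne _ _ h').symm
  refine ⟨a, ⟨adj, up, fun x => hreal x _ (.inr rfl), fun g => ?_⟩, haN⟩
  refine actsDihedrally_of_adj hn adj up (hΓ.adj_smul g) fun x y => ?_
  rw [haN, haN]
  refine ⟨fun h => ?_, orb_smul g⟩
  simpa only [inv_smul_smul] using orb_smul g⁻¹ h

/-- The converse passage from a label to a cycle; it is what contradicts independence in the
degenerate cases. -/
theorem nonempty_iso_cycleGraph [Nonempty V] {T : Subgroup G} {n : ℕ} (hn : 3 ≤ n)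
    {k : V → ZMod n} (hk : ∀ x y, k x = k y ↔ orb T x = orb T y)
    (adj : ∀ x y, Γ.Adj x y → k y = k x + 1 ∨ k y = k x - 1)
    (up : ∀ x, ∃ y, Γ.Adj x y ∧ k y = k x + 1) :
    Nonempty (normalQuotient Γ T ≃g SimpleGraph.cycleGraph n) := by
  have : NeZero n := ⟨by omega⟩
  obtain ⟨x₀⟩ := ‹Nonempty V›
  let F : Orbits T V → ZMod n := Quotient.lift k fun x y h => (hk x y).mpr (Quotient.sound h)
  have hF : ∀ x, F (orb T x) = k x := fun _ => rfl
  have hinj : Function.Injective F := by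
    intro B C
    induction B using Quotient.inductionOn
    induction C using Quotient.inductionOn
    exact fun h => (hk _ _).mp h
  have hsurj : Function.Surjective F := by
    choose f hf ef using up
    have hiter : ∀ m : ℕ, k (f^[m] x₀) = k x₀ + m := by
      intro m
      induction m with
      | zero => simp
      | succ m ih => rw [Function.iterate_succ_apply', ef, ih]; push_cast; ring
    exact fun c => ⟨orb T (f^[(c - k x₀).val] x₀), by
      rw [hF, hiter, ZMod.natCast_zmod_val]; ring⟩
  refine ⟨⟨(Equiv.ofBijective F ⟨hinj, hsurj⟩).trans (ZMod.finEquiv n).symm.toEquiv, ?_⟩⟩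
  intro B C
  rw [cycleGraph_adj_iff_finEquiv hn]
  simp only [Equiv.trans_apply, RingEquiv.toEquiv_eq_coe,
    RingEquiv.coe_toEquiv, RingEquiv.apply_symm_apply]
  constructor
  · have key : ∀ x C, F C = k x + 1 → (normalQuotient Γ T).Adj (orb T x) C := by
      intro x C h
      obtain ⟨y, hy, e⟩ := up x
      obtain rfl : orb T y = C := hinj (by rw [h, hF, e])
      refine ⟨fun h' => ?_, x, y, hy, rfl, rfl⟩
      rw [← hk, e] at h'
      exact one_ne_zero_zmod hn (by linear_combination -h')
    induction B using Quotient.inductionOn with | _ x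
    induction C using Quotient.inductionOn with | _ y
    rintro (h | h)
    · exact key x _ h
    · exact (key y (orb T x) (by
        have h : F (orb T y) = F (orb T x) - 1 := h
        rw [← hF y]; linear_combination -h)).symm
  · rintro ⟨-, x, y, h, rfl, rfl⟩
    exact adj x y h

end Labels

/-! ### Bidirectional labels: rigidity, stabilizers and slopes of arcs -/

section Slopes

variable {V : Type u} {G : Type v} [Group G] [MulAction G V] {Γ : SimpleGraph V} {Δ : Set (V × V)}
  {r s : ℕ} {a : V → ZMod r} {b : V → ZMod s}

namespace Bidirectional

/-- The four combinations of in/out with up/down give four distinct neighbours, so they exhaust the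
valency. -/
theorem exists_neighbors (h : Bidirectional Δ a) (hΓ : IsOG4 Γ G Δ) (hr : 3 ≤ r) (x : V) :
    ∃ y₁ y₂ z₁ z₂, (x, y₁) ∈ Δ ∧ (x, y₂) ∈ Δ ∧ (z₁, x) ∈ Δ ∧ (z₂, x) ∈ Δ ∧
      a y₁ = a x + 1 ∧ a y₂ = a x - 1 ∧ a z₁ = a x + 1 ∧ a z₂ = a x - 1 ∧
      ∀ w, Γ.Adj x w → w = y₁ ∨ w = y₂ ∨ w = z₁ ∨ w = z₂ := by
  have h2 := two_ne_zero_zmod hr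
  obtain ⟨y₁, hy₁, e₁⟩ := h.out_up x
  obtain ⟨y₂, hy₂, e₂⟩ := h.out_down x
  obtain ⟨z₁, hz₁, f₁⟩ := h.in_up x
  obtain ⟨z₂, hz₂, f₂⟩ := h.in_down x
  refine ⟨y₁, y₂, z₁, z₂, hy₁, hy₂, hz₁, hz₂, e₁, e₂, f₁, f₂, ?_⟩
  have hud : ∀ u d : V, a u = a x + 1 → a d = a x - 1 → u ≠ d := by
    rintro u d hu hd rfl
    exact h2 (by linear_combination hd - hu)
  have hio : ∀ y z : V, (x, y) ∈ Δ → (z, x) ∈ Δ → y ≠ z := by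
    rintro y z hy hz rfl
    exact hΓ.arc_asymm hy hz
  have hcard : ({y₁, y₂, z₁, z₂} : Set V).ncard = 4 := by
    rw [Set.ncard_insert_of_notMem, Set.ncard_insert_of_notMem, Set.ncard_pair]
    · exact hud _ _ f₁ f₂
    · rintro (h | h)
      · exact hio _ _ hy₂ hz₁ h
      · exact hio _ _ hy₂ hz₂ h
    · rintro (h | h | h)
      · exact hud _ _ e₁ e₂ h
      · exact hio _ _ hy₁ hz₁ h
      · exact hio _ _ hy₁ hz₂ h
  have hsub : ({y₁, y₂, z₁, z₂} : Set V) ⊆ Γ.neighborSet x := by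
    rintro w (rfl | rfl | rfl | rfl)
    · exact hΓ.adj_of_mem _ _ hy₁
    · exact hΓ.adj_of_mem _ _ hy₂
    · exact (hΓ.adj_of_mem _ _ hz₁).symm
    · exact (hΓ.adj_of_mem _ _ hz₂).symm
  have := hΓ.finite
  have heq := Set.eq_of_subset_of_ncard_le hsub (by rw [hcard, hΓ.valency])
  intro w hw
  have : w ∈ ({y₁, y₂, z₁, z₂} : Set V) := by rw [heq]; exact hw
  simpa using this

theorem out_unique (h : Bidirectional Δ a) (hΓ : IsOG4 Γ G Δ) (hr : 3 ≤ r) {x w w' : V}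
    (hw : (x, w) ∈ Δ) (hw' : (x, w') ∈ Δ) (e : a w = a w') : w = w' := by
  have h2 := two_ne_zero_zmod hr
  obtain ⟨y₁, y₂, z₁, z₂, hy₁, hy₂, hz₁, hz₂, e₁, e₂, f₁, f₂, hall⟩ := h.exists_neighbors hΓ hr x
  have key : ∀ w, (x, w) ∈ Δ → w = y₁ ∨ w = y₂ := by
    intro w hw
    rcases hall w (hΓ.adj_of_mem _ _ hw) with h | h | rfl | rfl
    · exact .inl h
    · exact .inr h
    · exact absurd hw (hΓ.arc_asymm hz₁)
    · exact absurd hw (hΓ.arc_asymm hz₂)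
  rcases key w hw with rfl | rfl <;> rcases key w' hw' with rfl | rfl
  · rfl
  · exact absurd (by linear_combination e + e₂ - e₁) h2
  · exact absurd (by linear_combination -e + e₂ - e₁) h2
  · rfl

theorem in_unique (h : Bidirectional Δ a) (hΓ : IsOG4 Γ G Δ) (hr : 3 ≤ r) {x w w' : V}
    (hw : (w, x) ∈ Δ) (hw' : (w', x) ∈ Δ) (e : a w = a w') : w = w' := by
  have h2 := two_ne_zero_zmod hr
  obtain ⟨y₁, y₂, z₁, z₂, hy₁, hy₂, hz₁, hz₂, e₁, e₂, f₁, f₂, hall⟩ := h.exists_neighbors hΓ hr x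
  have key : ∀ w, (w, x) ∈ Δ → w = z₁ ∨ w = z₂ := by
    intro w hw
    rcases hall w (hΓ.adj_of_mem _ _ hw).symm with rfl | rfl | h | h
    · exact absurd hw (hΓ.arc_asymm hy₁)
    · exact absurd hw (hΓ.arc_asymm hy₂)
    · exact .inl h
    · exact .inr h
  rcases key w hw with rfl | rfl <;> rcases key w' hw' with rfl | rfl
  · rfl
  · exact absurd (by linear_combination e + f₂ - f₁) h2
  · exact absurd (by linear_combination -e + f₂ - f₁) h2
  · rfl

/-- An arc-preserving map that fixes a vertex and all labels is the identity. -/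
theorem eq_self_of_fix (h : Bidirectional Δ a) (hΓ : IsOG4 Γ G Δ) (hr : 3 ≤ r) {p : V → V}
    (hp : ∀ x y, (x, y) ∈ Δ → (p x, p y) ∈ Δ) (hpa : ∀ v, a (p v) = a v) {x : V} (hx : p x = x)
    (v : V) : p v = v := by
  refine connected_induction hΓ.connected (P := fun v => p v = v) x hx ?_ v
  intro v w hvw hv
  rcases hΓ.adj_iff.mp hvw with h' | h'
  · have := hp _ _ h'
    rw [hv] at this
    exact h.out_unique hΓ hr this h' (hpa w)
  · have := hp _ _ h'
    rw [hv] at this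
    exact h.in_unique hΓ hr this h' (hpa w)

theorem eq_one_of_fix (h : Bidirectional Δ a) (hΓ : IsOG4 Γ G Δ) (hr : 3 ≤ r) {g : G} {x : V}
    (hx : g • x = x) (hg : ∀ v, a (g • v) = a v) : g = 1 :=
  hΓ.eq_one_of_smul_eq (h.eq_self_of_fix hΓ hr (p := fun v => g • v)
    (fun _ _ => hΓ.arc_smul g) hg hx)

/-- Arc-transitivity gives an element of the stabilizer taking the upper out-neighbour to the lower
one; it moves a label, so it must reflect. -/
theorem exists_reflect (h : Bidirectional Δ a) (hΓ : IsOG4 Γ G Δ) (hr : 3 ≤ r)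
    (ha : CycleLabel Γ G a) (x : V) :
    ∃ g : G, g • x = x ∧ ∀ v, a (g • v) = 2 * a x - a v := by
  have h2 := two_ne_zero_zmod hr
  obtain ⟨y₁, hy₁, e₁⟩ := h.out_up x
  obtain ⟨y₂, hy₂, e₂⟩ := h.out_down x
  obtain ⟨g, hg, rfl⟩ := hΓ.exists_smul_arc hy₁ hy₂
  refine ⟨g, hg, (ha.fix_or_reflect (by rw [hg])).resolve_left fun h' => ?_⟩
  have := h' y₁
  exact h2 (by linear_combination e₂ - this - e₁)

/-- Two elements of the stabilizer that both reflect differ by an element fixing all labels, which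
is trivial by rigidity. -/
theorem nonempty_stabilizer_mulEquiv (h : Bidirectional Δ a) (hΓ : IsOG4 Γ G Δ) (hr : 3 ≤ r)
    (ha : CycleLabel Γ G a) (x : V) :
    Nonempty (MulAction.stabilizer G x ≃* Multiplicative (ZMod 2)) := by
  have h2 := two_ne_zero_zmod hr
  obtain ⟨t, ht, hta⟩ := h.exists_reflect hΓ hr ha x
  have ht1 : t ≠ 1 := by
    rintro rfl
    obtain ⟨y, hy, e⟩ := h.out_up x
    have := hta y
    rw [one_smul] at this
    exact h2 (by linear_combination this - 2 * e)
  have hall : ∀ g : G, g • x = x → g = 1 ∨ g = t := by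
    intro g hg
    rcases ha.fix_or_reflect (show a (g • x) = a x by rw [hg]) with h' | h'
    · exact .inl (h.eq_one_of_fix hΓ hr hg h')
    · right
      have hi : t⁻¹ • x = x := by rw [inv_smul_eq_iff, ht]
      have : t⁻¹ * g = 1 := by
        refine h.eq_one_of_fix hΓ hr (x := x) (by rw [mul_smul, hg, hi]) fun v => ?_
        have h1 := hta (t⁻¹ • g • v)
        rw [smul_inv_smul] at h1
        rw [mul_smul]
        linear_combination h1 - h' v
      exact (inv_mul_eq_one.mp this).symm
  have hcard : Nat.card (MulAction.stabilizer G x) = 2 := by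
    rw [Nat.card_eq_two_iff]
    refine ⟨1, ⟨t, ht⟩, fun e => ht1 (congrArg Subtype.val e).symm, ?_⟩
    ext ⟨g, hg⟩
    simpa [Subtype.ext_iff] using hall g hg
  have : Fact (Nat.Prime 2) := ⟨Nat.prime_two⟩
  exact ⟨mulEquivOfPrimeCardEq (p := 2) hcard (by simp)⟩

/-- Vertices with equal labels, for which some out-neighbours also have equal labels, are
related by an element that fixes all labels. -/
theorem exists_smul_fixing (h : Bidirectional Δ a) (hΓ : IsOG4 Γ G Δ) (hr : 3 ≤ r)
    (hs : 3 ≤ s) (ha : CycleLabel Γ G a) (hb : CycleLabel Γ G b) {x x' y y' : V}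
    (ex : a x = a x') (fx : b x = b x') (hy : (x, y) ∈ Δ) (hy' : (x', y') ∈ Δ)
    (ey : a y' = a y) (fy : b y = b y') :
    ∃ g : G, g • x = x' ∧ ∀ v, a (g • v) = a v ∧ b (g • v) = b v := by
  have h2 := two_ne_zero_zmod hs
  obtain ⟨g, hg, hga⟩ : ∃ g : G, g • x = x' ∧ ∀ v, a (g • v) = a v := by
    obtain ⟨g, hg⟩ := hΓ.exists_smul_eq x x'
    rcases ha.fix_or_reflect (show a (g • x) = a x by rw [hg, ex]) with h' | h'
    · exact ⟨g, hg, h'⟩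
    · obtain ⟨t, ht, hta⟩ := h.exists_reflect hΓ hr ha x
      -- If the element found reflects `a`, composing it with the reflection in the stabilizer of
      -- `x` undoes this.
      exact ⟨g * t, by rw [mul_smul, ht, hg], fun v => by rw [mul_smul, h', hta]; ring⟩
  refine ⟨g, hg, fun v => ⟨hga v, ?_⟩⟩
  have hgy : g • y = y' := by
    have := hΓ.arc_smul g hy
    rw [hg] at this
    exact h.out_unique hΓ hr this hy' (by rw [hga, ey])
  -- The given out-neighbours correspond under `g` and have equal `b`-labels, which excludes a
  -- reflection of `b`.
  rcases hb.fix_or_reflect (show b (g • x) = b x by rw [hg, fx]) with h' | h'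
  · exact h' v
  · have := h' y
    rw [hgy, ← fy] at this
    rcases hb.adj x y (hΓ.adj_of_mem _ _ hy) with e | e
    · exact absurd (by linear_combination this - 2 * e) h2
    · exact absurd (by linear_combination -this + 2 * e) h2

end Bidirectional

/-- A reflection of the label would reverse the direction of the arcs. -/
theorem Oriented.fix (h : Oriented Δ b) (hΓ : IsOG4 Γ G Δ) (hs : 3 ≤ s)
    (hb : CycleLabel Γ G b) {g : G} {x : V} (hg : b (g • x) = b x) (v : V) :
    b (g • v) = b v := by
  have h2 := two_ne_zero_zmod hs
  rcases hb.fix_or_reflect hg with h' | h'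
  · exact h' v
  · obtain ⟨y, hy⟩ := hΓ.exists_out x
    have hy' := hΓ.arc_smul g hy
    rcases h with h | h
    · exact absurd (by linear_combination -(h _ _ hy) - h _ _ hy' + h' y - hg) h2
    · exact absurd (by linear_combination (h _ _ hy) + h _ _ hy' - h' y + hg) h2

/-- If all edges run along one diagonal direction, then the quotient is a cycle. -/
theorem isCycleGraph_of_diagonal (hΓ : IsOG4 Γ G Δ) (hr : 3 ≤ r) (hs : 3 ≤ s)
    (ha : CycleLabel Γ G a) {T : Subgroup G}
    (hfib : ∀ x y, (a x = a y ∧ b x = b y) ↔ orb T x = orb T y) (ε : ZMod s)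
    (hdiag : ∀ x y, (x, y) ∈ Δ →
      (a y = a x + 1 ∧ b y = b x + ε) ∨ (a y = a x - 1 ∧ b y = b x - ε)) :
    IsCycleGraph (normalQuotient Γ T) := by
  have hne := hΓ.connected.nonempty
  have : NeZero r := ⟨by omega⟩
  have : NeZero s := ⟨by omega⟩
  have h2 := two_ne_zero_zmod hr
  obtain ⟨x₀⟩ := hΓ.connected.nonempty
  have hadj : ∀ x y, Γ.Adj x y →
      (a y = a x + 1 ∧ b y = b x + ε) ∨ (a y = a x - 1 ∧ b y = b x - ε) := by
    intro x y h
    rcases hΓ.adj_iff.mp h with h | h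
    · exact hdiag x y h
    · rcases hdiag y x h with ⟨e, f⟩ | ⟨e, f⟩
      · exact .inr ⟨by rw [e]; ring, by rw [f]; ring⟩
      · exact .inl ⟨by rw [e]; ring, by rw [f]; ring⟩
  -- All label pairs lie in one coset of the cyclic group generated by `t`, and the position `k v`
  -- in this coset, modulo the order of `t`, is the label of the cycle sought.
  let t : ZMod r × ZMod s := (1, ε)
  have hex : ∀ v, ∃ k : ℤ, (a v, b v) = (a x₀, b x₀) + k • t := by
    refine connected_induction hΓ.connected x₀ ⟨0, by simp⟩ ?_
    rintro v w hvw ⟨k, hk⟩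
    rcases hadj v w hvw with ⟨e, f⟩ | ⟨e, f⟩
    · exact ⟨k + 1, by rw [add_smul, ← add_assoc, ← hk, e, f]; simp [t]⟩
    · exact ⟨k - 1, by rw [sub_smul, ← add_sub_assoc, ← hk, e, f]; simp [t]⟩
  choose k hk using hex
  -- The first coordinate of `t` is 1, so `r` divides the order of `t`.
  have hn : 3 ≤ addOrderOf t := by
    have h1 : addOrderOf t • t = 0 := addOrderOf_nsmul_eq_zero t
    have h1' : ((addOrderOf t : ℕ) : ZMod r) = 0 := by
      have := congrArg Prod.fst h1
      simpa [t] using this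
    have hpos : 0 < addOrderOf t := addOrderOf_pos t
    exact hr.trans (Nat.le_of_dvd hpos ((ZMod.natCast_eq_zero_iff _ _).mp h1'))
  have hkeq : ∀ {v w : V} {m : ℤ}, (a w, b w) = (a v, b v) + m • t →
      ((k w : ℤ) : ZMod (addOrderOf t)) = k v + m := by
    intro v w m h
    rw [hk w, hk v, add_assoc, ← add_smul] at h
    have := zsmul_eq_zsmul_iff_modEq.mp (add_left_cancel h)
    have := (ZMod.intCast_eq_intCast_iff _ _ _).mpr this
    rw [this]
    push_cast
    rfl
  have hstep : ∀ x y, Γ.Adj x y → (a y = a x + 1 ∧ ((k y : ℤ) : ZMod (addOrderOf t)) = k x + 1) ∨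
      (a y = a x - 1 ∧ ((k y : ℤ) : ZMod (addOrderOf t)) = k x - 1) := by
    intro x y h
    rcases hadj x y h with ⟨e, f⟩ | ⟨e, f⟩
    · exact .inl ⟨e, by have := hkeq (v := x) (w := y) (m := 1) (by simp [t, e, f]); simpa using this⟩
    · right
      refine ⟨e, ?_⟩
      have := hkeq (v := x) (w := y) (m := -1) (by simp [t, e, f, sub_eq_add_neg])
      rw [this]
      push_cast
      ring
  refine ⟨addOrderOf t, hn, nonempty_iso_cycleGraph hn
    (k := fun v => ((k v : ℤ) : ZMod (addOrderOf t))) ?_ ?_ ?_⟩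
  · intro x y
    rw [← hfib, ZMod.intCast_eq_intCast_iff, ← zsmul_eq_zsmul_iff_modEq, ← Prod.mk_inj, hk x, hk y,
      add_right_inj]
  · intro x y h
    rcases hstep x y h with h | h
    · exact .inl h.2
    · exact .inr h.2
  · intro x
    obtain ⟨y, hy, e⟩ := ha.up x
    refine ⟨y, hy, ?_⟩
    rcases hstep x y hy with h | h
    · exact h.2
    · exact absurd (by linear_combination h.1 - e) h2

theorem orb_eq_iff_of_exists {T : Subgroup G}
    (hT : ∀ g, g ∈ T ↔ ∀ v, a (g • v) = a v ∧ b (g • v) = b v)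
    (h : ∀ x x', a x = a x' → b x = b x' →
      ∃ g : G, g • x = x' ∧ ∀ v, a (g • v) = a v ∧ b (g • v) = b v) (x y : V) :
    (a x = a y ∧ b x = b y) ↔ orb T x = orb T y := by
  constructor
  · rintro ⟨e, f⟩
    obtain ⟨g, rfl, hg⟩ := h x y e f
    exact (orb_smul_of_mem ((hT g).mpr hg) x).symm
  · intro h
    obtain ⟨g, hg, rfl⟩ := exists_smul_of_orb_eq h
    have := (hT g).mp hg x
    exact ⟨this.1.symm, this.2.symm⟩

/-- Here any element matching the labels at one vertex fixes all labels, so `T`-orbits are the label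
fibres, and a single diagonal direction is left. The four cases differ only in the sign of that
diagonal. -/
theorem isCycleGraph_of_oriented (hΓ : IsOG4 Γ G Δ) (hr : 3 ≤ r) (hs : 3 ≤ s)
    (ha : CycleLabel Γ G a) (hb : CycleLabel Γ G b) {T : Subgroup G}
    (hT : ∀ g, g ∈ T ↔ ∀ v, a (g • v) = a v ∧ b (g • v) = b v)
    (hao : Oriented Δ a) (hbo : Oriented Δ b) : IsCycleGraph (normalQuotient Γ T) := by
  have hfib := orb_eq_iff_of_exists hT fun x x' e f => by
    obtain ⟨g, rfl⟩ := hΓ.exists_smul_eq x x'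
    exact ⟨g, rfl, fun v => ⟨hao.fix hΓ hr ha e.symm v, hbo.fix hΓ hs hb f.symm v⟩⟩
  rcases hao with ha' | ha' <;> rcases hbo with hb' | hb'
  · exact isCycleGraph_of_diagonal hΓ hr hs ha hfib 1 fun x y h => .inl ⟨ha' x y h, hb' x y h⟩
  · exact isCycleGraph_of_diagonal hΓ hr hs ha hfib (-1)
      fun x y h => .inl ⟨ha' x y h, by rw [hb' x y h]; ring⟩
  · exact isCycleGraph_of_diagonal hΓ hr hs ha hfib (-1)
      fun x y h => .inr ⟨ha' x y h, by rw [hb' x y h]; ring⟩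
  · exact isCycleGraph_of_diagonal hΓ hr hs ha hfib 1 fun x y h => .inr ⟨ha' x y h, hb' x y h⟩

/-- The sign `(-1)^δ` for `δ ∈ ℤ₂`. -/
def sgnTwo (s : ℕ) (δ : ZMod 2) : ZMod s := (-1) ^ δ.val

theorem sgnTwo_zero : sgnTwo s 0 = 1 := by simp [sgnTwo]

theorem sgnTwo_one : sgnTwo s 1 = -1 := by
  have : (1 : ZMod 2).val = 1 := rfl
  simp [sgnTwo, this]

theorem zmod_two_cases (δ : ZMod 2) : δ = 0 ∨ δ = 1 := by
  revert δ; decide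

theorem sgnTwo_add_one (δ : ZMod 2) : sgnTwo s (δ + 1) = -sgnTwo s δ := by
  rcases zmod_two_cases δ with rfl | rfl
  · rw [zero_add, sgnTwo_one, sgnTwo_zero]
  · rw [show (1 : ZMod 2) + 1 = 0 from rfl, sgnTwo_one, sgnTwo_zero, neg_neg]

theorem sgnTwo_injective (hs : 3 ≤ s) : Function.Injective (sgnTwo s) := by
  have h2 := two_ne_zero_zmod hs
  intro δ δ' h
  rcases zmod_two_cases δ with rfl | rfl <;> rcases zmod_two_cases δ' with rfl | rfl <;>
    simp only [sgnTwo_one, sgnTwo_zero] at h ⊢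
  · exact absurd (by linear_combination h) h2
  · exact absurd (by linear_combination -h) h2

/-- The arcs out of `x` lead in the directions `±(1, (-1)^(e x))`. -/
def IsSlope (Δ : Set (V × V)) (a : V → ZMod r) (b : V → ZMod s) (e : V → ZMod 2) : Prop :=
  ∀ x y, (x, y) ∈ Δ → (a y = a x + 1 ∧ b y = b x + sgnTwo s (e x)) ∨
    (a y = a x - 1 ∧ b y = b x - sgnTwo s (e x))

/-- The two out-neighbours of a vertex lie on opposite sides for `a`. Since `b` is bidirectional as
well, they lie on opposite sides for `b`, so their directions are opposite vectors. -/
theorem exists_isSlope (hΓ : IsOG4 Γ G Δ) (hr : 3 ≤ r) (hs : 3 ≤ s)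
    (ha : CycleLabel Γ G a) (hb : CycleLabel Γ G b) (hA : Bidirectional Δ a)
    (hB : Bidirectional Δ b) : ∃ e, IsSlope Δ a b e := by
  have hr2 := two_ne_zero_zmod hr
  have hs2 := two_ne_zero_zmod hs
  have key : ∀ x, ∃ δ : ZMod 2, ∀ y, (x, y) ∈ Δ → (a y = a x + 1 ∧ b y = b x + sgnTwo s δ) ∨
      (a y = a x - 1 ∧ b y = b x - sgnTwo s δ) := by
    intro x
    obtain ⟨y₁, hy₁, e₁⟩ := hA.out_up x
    obtain ⟨y₂, hy₂, e₂⟩ := hA.out_down x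
    have hne : b y₁ ≠ b y₂ := fun h => by
      obtain rfl := hB.out_unique hΓ hs hy₁ hy₂ h
      exact hr2 (by linear_combination e₂ - e₁)
    have hall : ∀ y, (x, y) ∈ Δ → y = y₁ ∨ y = y₂ := by
      intro y hy
      rcases ha.adj x y (hΓ.adj_of_mem _ _ hy) with h | h
      · exact .inl (hA.out_unique hΓ hr hy hy₁ (h.trans e₁.symm))
      · exact .inr (hA.out_unique hΓ hr hy hy₂ (h.trans e₂.symm))
    have hb₁ := hb.adj x y₁ (hΓ.adj_of_mem _ _ hy₁)
    have hb₂ := hb.adj x y₂ (hΓ.adj_of_mem _ _ hy₂)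
    rcases hb₁ with h₁ | h₁
    · refine ⟨0, fun y hy => ?_⟩
      have h₂ := hb₂.resolve_left fun h₂ => hne (h₁.trans h₂.symm)
      rw [sgnTwo_zero]
      rcases hall y hy with rfl | rfl
      · exact .inl ⟨e₁, h₁⟩
      · exact .inr ⟨e₂, h₂⟩
    · refine ⟨1, fun y hy => ?_⟩
      have h₂ := hb₂.resolve_right fun h₂ => hne (h₁.trans h₂.symm)
      rw [sgnTwo_one]
      rcases hall y hy with rfl | rfl
      · exact .inl ⟨e₁, by rw [h₁]; ring⟩
      · exact .inr ⟨e₂, by rw [h₂]; ring⟩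
  choose e he using key
  exact ⟨e, he⟩

namespace IsSlope

variable {e : V → ZMod 2}

theorem b_of_up (he : IsSlope Δ a b e) (hr : 3 ≤ r) {x y : V} (h : (x, y) ∈ Δ)
    (hy : a y = a x + 1) : b y = b x + sgnTwo s (e x) := by
  rcases he x y h with h' | h'
  · exact h'.2
  · exact absurd (by linear_combination h'.1 - hy) (two_ne_zero_zmod hr)

theorem b_of_down (he : IsSlope Δ a b e) (hr : 3 ≤ r) {x y : V} (h : (x, y) ∈ Δ)
    (hy : a y = a x - 1) : b y = b x - sgnTwo s (e x) := by
  rcases he x y h with h' | h'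
  · exact absurd (by linear_combination -h'.1 + hy) (two_ne_zero_zmod hr)
  · exact h'.2

/-- Directions up to sign are either `(1, 1)` or `(1, -1)`. Reflecting exactly one of the two labels
exchanges these classes; rotating both or reflecting both preserves them. -/
theorem smul (he : IsSlope Δ a b e) (hΓ : IsOG4 Γ G Δ) (hr : 3 ≤ r) (hs : 3 ≤ s)
    (ha : CycleLabel Γ G a) (hb : CycleLabel Γ G b) (hA : Bidirectional Δ a) (g : G) :
    ∃ κ : ZMod 2, ∀ x, e (g • x) = e x + κ := by
  have hneg : ∀ δ δ' : ZMod 2, sgnTwo s δ' = -sgnTwo s δ → δ' = δ + 1 := fun δ δ' h =>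
    sgnTwo_injective hs (by rw [h, sgnTwo_add_one])
  rcases ha.dihedral g with ⟨c, hc⟩ | ⟨c, hc⟩ <;> rcases hb.dihedral g with ⟨d, hd⟩ | ⟨d, hd⟩ <;>
    simp only at hc hd
  · refine ⟨0, fun x => ?_⟩
    obtain ⟨y, hy, ey⟩ := hA.out_up x
    have h1 := he.b_of_up hr hy ey
    have h2 := he.b_of_up hr (hΓ.arc_smul g hy) (by rw [hc, hc, ey]; ring)
    rw [hd, hd, h1] at h2
    rw [add_zero]
    exact sgnTwo_injective hs (by linear_combination -h2)
  · refine ⟨1, fun x => hneg _ _ ?_⟩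
    obtain ⟨y, hy, ey⟩ := hA.out_up x
    have h1 := he.b_of_up hr hy ey
    have h2 := he.b_of_up hr (hΓ.arc_smul g hy) (by rw [hc, hc, ey]; ring)
    rw [hd, hd, h1] at h2
    linear_combination -h2
  · refine ⟨1, fun x => hneg _ _ ?_⟩
    obtain ⟨y, hy, ey⟩ := hA.out_up x
    have h1 := he.b_of_up hr hy ey
    have h2 := he.b_of_down hr (hΓ.arc_smul g hy) (by rw [hc, hc, ey]; ring)
    rw [hd, hd, h1] at h2
    linear_combination h2
  · refine ⟨0, fun x => ?_⟩
    obtain ⟨y, hy, ey⟩ := hA.out_up x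
    have h1 := he.b_of_up hr hy ey
    have h2 := he.b_of_down hr (hΓ.arc_smul g hy) (by rw [hc, hc, ey]; ring)
    rw [hd, hd, h1] at h2
    rw [add_zero]
    exact sgnTwo_injective hs (by linear_combination h2)

/-- If the slope persisted along one arc it would persist along all, by arc-transitivity and `smul`,
and so be constant. Then all arcs would run along one diagonal and the quotient by `T` would be a
cycle. This is where independence enters when both labels are bidirectional. -/
theorem flip (he : IsSlope Δ a b e) (hΓ : IsOG4 Γ G Δ) (hr : 3 ≤ r) (hs : 3 ≤ s)
    (ha : CycleLabel Γ G a) (hb : CycleLabel Γ G b) (hA : Bidirectional Δ a)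
    {T : Subgroup G} (hT : ∀ g, g ∈ T ↔ ∀ v, a (g • v) = a v ∧ b (g • v) = b v)
    (hcyc : ¬ IsCycleGraph (normalQuotient Γ T)) {x y : V} (hxy : (x, y) ∈ Δ) :
    e y = e x + 1 := by
  by_contra hne
  have heq : e y = e x := by
    revert hne
    generalize e x = δ
    generalize e y = δ'
    revert δ δ'
    decide
  have hall : ∀ v w, (v, w) ∈ Δ → e w = e v := by
    intro v w h
    obtain ⟨g, rfl, rfl⟩ := hΓ.exists_smul_arc hxy h
    obtain ⟨κ, hκ⟩ := he.smul hΓ hr hs ha hb hA g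
    rw [hκ, hκ, heq]
  have hconst : ∀ v, e v = e x := connected_induction hΓ.connected x rfl fun v w hvw hv => by
    rcases hΓ.adj_iff.mp hvw with h | h
    · rw [hall _ _ h, hv]
    · rw [← hall _ _ h, hv]
  refine hcyc (isCycleGraph_of_diagonal hΓ hr hs ha (orb_eq_iff_of_exists hT fun v v' h h' => ?_)
    (sgnTwo s (e x)) fun v w h => by have := he v w h; rwa [hconst v] at this)
  obtain ⟨w, hw, ew⟩ := hA.out_up v
  obtain ⟨w', hw', ew'⟩ := hA.out_up v'
  exact hA.exists_smul_fixing hΓ hr hs ha hb h h' hw hw' (by rw [ew, ew', h])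
    (by rw [he.b_of_up hr hw ew, he.b_of_up hr hw' ew', hconst v, hconst v', h'])

end IsSlope

/-- Two out-neighbours, or two in-neighbours, are already separated by `a`. An in-neighbour and an
out-neighbour lie on opposite sides for `b` if `b` is oriented; otherwise the slopes at the two ends
of an arc differ, so if they agree in `a` they differ by `±2` in `b`. -/
theorem label_injective_on_neighbors (hΓ : IsOG4 Γ G Δ) (hr : 3 ≤ r) (hs : 3 ≤ s)
    (ha : CycleLabel Γ G a) (hb : CycleLabel Γ G b) (hA : Bidirectional Δ a)
    {T : Subgroup G} (hT : ∀ g, g ∈ T ↔ ∀ v, a (g • v) = a v ∧ b (g • v) = b v)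
    (hcyc : ¬ IsCycleGraph (normalQuotient Γ T)) {x w w' : V} (hw : Γ.Adj x w)
    (hw' : Γ.Adj x w') (e : a w = a w') (f : b w = b w') : w = w' := by
  have hr2 := two_ne_zero_zmod hr
  have hs2 := two_ne_zero_zmod hs
  have key : ∀ w w', (x, w) ∈ Δ → (w', x) ∈ Δ → a w = a w' → b w = b w' → False := by
    intro w w' hw hw' e f
    rcases hb.oriented_or_bidirectional hΓ hs with (h | h) | hB
    · exact hs2 (by linear_combination f - h _ _ hw - h _ _ hw')
    · exact hs2 (by linear_combination -f + h _ _ hw + h _ _ hw')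
    · obtain ⟨sl, hsl⟩ := exists_isSlope hΓ hr hs ha hb hA hB
      have hfl := hsl.flip hΓ hr hs ha hb hA hT hcyc hw'
      have hsg : sgnTwo s (sl x) = -sgnTwo s (sl w') := by rw [hfl, sgnTwo_add_one]
      have hne : 2 * sgnTwo s (sl w') ≠ 0 := by
        rcases zmod_two_cases (sl w') with h | h <;> rw [h]
        · rw [sgnTwo_zero]; simpa using hs2
        · rw [sgnTwo_one]; simpa using hs2
      rcases hsl _ _ hw with ⟨p, q⟩ | ⟨p, q⟩ <;> rcases hsl _ _ hw' with ⟨p', q'⟩ | ⟨p', q'⟩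
      · exact hr2 (by linear_combination e - p - p')
      · exact hne (by linear_combination q + q' - f + hsg)
      · exact hne (by linear_combination f - q - q' + hsg)
      · exact hr2 (by linear_combination -e + p + p')
  rcases hΓ.adj_iff.mp hw with h | h <;> rcases hΓ.adj_iff.mp hw' with h' | h'
  · exact hA.out_unique hΓ hr h h' e
  · exact (key _ _ h h' e f).elim
  · exact (key _ _ h' h e.symm f.symm).elim
  · exact hA.in_unique hΓ hr h h' e

end Slopes

/-! ### The quotient by the common kernel and its induced labels -/

section Quotients

variable {V : Type u} {G : Type v} [Group G] [MulAction G V] {Γ : SimpleGraph V} {Δ : Set (V × V)}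
  {r s : ℕ} {a : V → ZMod r} {b : V → ZMod s} {T : Subgroup G}

theorem IsCycleGraph.of_iso {W : Type w} {Γ' : SimpleGraph W} (h : IsCycleGraph Γ)
    (f : Γ ≃g Γ') : IsCycleGraph Γ' := by
  obtain ⟨n, hn, ⟨k⟩⟩ := h
  exact ⟨n, hn, ⟨f.symm.trans k⟩⟩

theorem le_orbitKernel (N : Subgroup G) : N ≤ orbitKernel N V := fun _ hg x => orb_smul_of_mem hg x

theorem mem_orbitKernel_iff {N : Subgroup G} (haN : ∀ x y, a x = a y ↔ orb N x = orb N y) (g : G) :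
    g ∈ orbitKernel N V ↔ ∀ x, a (g • x) = a x :=
  forall_congr' fun x => (haN (g • x) x).symm

theorem label_eq_of_orb_eq (hT : ∀ g, g ∈ T ↔ ∀ v, a (g • v) = a v ∧ b (g • v) = b v) {x y : V}
    (h : orb T x = orb T y) : a x = a y ∧ b x = b y := by
  obtain ⟨g, hg, rfl⟩ := exists_smul_of_orb_eq h
  have := (hT g).mp hg x
  exact ⟨this.1.symm, this.2.symm⟩

theorem exists_adj_of_quotient_adj (hΓ : IsOG4 Γ G Δ) {x : V} {C : Orbits T V}
    (h : (normalQuotient Γ T).Adj (orb T x) C) : ∃ y, orb T y = C ∧ Γ.Adj x y := by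
  obtain ⟨-, x', y', h, hx', hy'⟩ := h
  obtain ⟨g, hg, rfl⟩ := exists_smul_of_orb_eq hx'
  exact ⟨g • y', (orb_smul_of_mem hg y').trans hy', hΓ.adj_smul g _ _ h⟩

theorem quotient_adj_of_adj (hr : 3 ≤ r) (ha : CycleLabel Γ G a)
    (hT : ∀ g, g ∈ T ↔ ∀ v, a (g • v) = a v ∧ b (g • v) = b v) {x y : V} (h : Γ.Adj x y) :
    (normalQuotient Γ T).Adj (orb T x) (orb T y) := by
  refine ⟨fun h' => ?_, x, y, h, rfl, rfl⟩
  have h1 := one_ne_zero_zmod hr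
  have := (label_eq_of_orb_eq hT h').1
  rcases ha.adj x y h with e | e
  · exact h1 (by linear_combination -e - this)
  · exact h1 (by linear_combination e + this)

theorem isNormalCover_of_label_injective (hΓ : IsOG4 Γ G Δ)
    (hT : ∀ g, g ∈ T ↔ ∀ v, a (g • v) = a v ∧ b (g • v) = b v)
    (hinj : ∀ x w w', Γ.Adj x w → Γ.Adj x w' → a w = a w' → b w = b w' → w = w') :
    IsNormalCover Γ T := by
  rintro B C h x rfl
  obtain ⟨y, hy, hxy⟩ := exists_adj_of_quotient_adj hΓ h
  refine ⟨y, ⟨hy, hxy⟩, ?_⟩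
  rintro z ⟨hz, hxz⟩
  have := label_eq_of_orb_eq hT (hz.trans hy.symm)
  exact hinj x z y hxz hxy this.1 this.2

theorem IsNormalCover.eq_of_orb_eq (hc : IsNormalCover Γ T) {x w w' : V} (hw : Γ.Adj x w)
    (hw' : Γ.Adj x w') (hne : orb T x ≠ orb T w) (h : orb T w = orb T w') : w = w' :=
  (hc (orb T x) (orb T w) ⟨hne, x, w, hw, rfl, rfl⟩ x rfl).unique ⟨rfl, hw⟩ ⟨h.symm, hw'⟩

/-- The cover property keeps the valency equal to 4 and prevents arcs in both directions between two
`T`-orbits. Faithfulness holds because an element fixing every `T`-orbit fixes all labels, hence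
lies in `T`. -/
theorem isOG4_quotient [hTn : T.Normal] (hΓ : IsOG4 Γ G Δ) (hr : 3 ≤ r)
    (ha : CycleLabel Γ G a) (hT : ∀ g, g ∈ T ↔ ∀ v, a (g • v) = a v ∧ b (g • v) = b v)
    (hc : IsNormalCover Γ T) :
    IsOG4 (normalQuotient Γ T) (G ⧸ T) (quotientArcs Δ T) := by
  have hadj : ∀ {x y}, Γ.Adj x y → (normalQuotient Γ T).Adj (orb T x) (orb T y) :=
    quotient_adj_of_adj hr ha hT
  have hfin := hΓ.finite
  have hEdge : ∀ B C, (normalQuotient Γ T).Adj B C →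
      ∃ x y, ((x, y) ∈ Δ ∧ ((B = orb T x ∧ C = orb T y) ∨ (B = orb T y ∧ C = orb T x))) := by
    rintro B C ⟨-, x, y, h, rfl, rfl⟩
    rcases hΓ.adj_iff.mp h with h | h
    · exact ⟨x, y, h, .inl ⟨rfl, rfl⟩⟩
    · exact ⟨y, x, h, .inr ⟨rfl, rfl⟩⟩
  -- Translate a supposed reverse arc by `T` so that it ends at `x`. Its origin lies in the orbit of
  -- `y` and is adjacent to `x`, so it is `y` by the cover property, contradicting asymmetry of `Δ`.
  have hanti : ∀ x y, (x, y) ∈ Δ → (orb T y, orb T x) ∉ quotientArcs Δ T := by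
    rintro x y hxy ⟨y', x', h, hy', hx'⟩
    obtain ⟨t, ht, rfl⟩ := exists_smul_of_orb_eq hx'
    have h1 := hΓ.arc_smul t h
    have hy'' : orb T y = orb T (t • y') := ((orb_smul_of_mem ht y').trans hy').symm
    have := hc.eq_of_orb_eq (hΓ.adj_of_mem _ _ hxy) (hΓ.adj_of_mem _ _ h1).symm
      (hadj (hΓ.adj_of_mem _ _ hxy)).1 hy''
    rw [← this] at h1
    exact hΓ.arc_asymm hxy h1
  refine
    { finite := inferInstance
      connected := ?_
      valency := ?_
      faithful := ⟨?_⟩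
      adj_smul := ?_
      vertex_transitive := ⟨?_⟩
      edge_transitive := ?_
      isOrbit := ?_
      adj_of_mem := ?_
      one_per_edge := ?_ }
  · exact hΓ.connected.map (H := normalQuotient Γ T) ⟨orb T, hadj⟩ Quotient.mk_surjective
  · intro B
    induction B using Quotient.inductionOn with | _ x
    have : (normalQuotient Γ T).neighborSet (orb T x) = orb T '' Γ.neighborSet x := by
      ext C
      constructor
      · intro h
        obtain ⟨y, hy, hxy⟩ := exists_adj_of_quotient_adj hΓ h
        exact ⟨y, hxy, hy⟩
      · rintro ⟨y, hy, rfl⟩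
        exact hadj hy
    change ((normalQuotient Γ T).neighborSet (orb T x)).ncard = 4
    rw [this, Set.InjOn.ncard_image, hΓ.valency]
    intro w hw w' hw' h
    exact hc.eq_of_orb_eq hw hw' (hadj hw).1 h
  · intro p q h
    induction p using QuotientGroup.induction_on with | _ g
    induction q using QuotientGroup.induction_on with | _ k
    refine QuotientGroup.eq.mpr ((hT _).mpr fun v => ?_)
    have h' : orb T (g • v) = orb T (k • v) := h (orb T v)
    have h'' := orb_smul g⁻¹ h'
    rw [inv_smul_smul, ← mul_smul] at h''
    have := label_eq_of_orb_eq hT h''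
    exact ⟨this.1.symm, this.2.symm⟩
  · rintro p _ _ ⟨-, x, y, h, rfl, rfl⟩
    induction p using QuotientGroup.induction_on with | _ g
    exact hadj (hΓ.adj_smul g _ _ h)
  · intro B C
    induction B using Quotient.inductionOn with | _ x
    induction C using Quotient.inductionOn with | _ y
    obtain ⟨g, rfl⟩ := hΓ.exists_smul_eq x y
    exact ⟨QuotientGroup.mk g, rfl⟩
  · intro e he e' he'
    induction e using Sym2.inductionOn with | _ B C
    induction e' using Sym2.inductionOn with | _ B' C'
    rw [SimpleGraph.mem_edgeSet] at he he'
    obtain ⟨x, y, h, hBC⟩ := hEdge B C he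
    obtain ⟨x', y', h', hBC'⟩ := hEdge B' C' he'
    obtain ⟨g, rfl, rfl⟩ := hΓ.exists_smul_arc h h'
    refine ⟨QuotientGroup.mk g, ?_⟩
    rw [Sym2.map_mk, Sym2.eq_iff]
    rcases hBC with ⟨rfl, rfl⟩ | ⟨rfl, rfl⟩ <;> rcases hBC' with ⟨rfl, rfl⟩ | ⟨rfl, rfl⟩
    · exact .inl ⟨rfl, rfl⟩
    · exact .inr ⟨rfl, rfl⟩
    · exact .inr ⟨rfl, rfl⟩
    · exact .inl ⟨rfl, rfl⟩
  · obtain ⟨x⟩ := hΓ.connected.nonempty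
    obtain ⟨y, hy⟩ := hΓ.exists_out x
    refine ⟨(orb T x, orb T y), ?_⟩
    ext ⟨B, C⟩
    constructor
    · rintro ⟨x', y', h, hB, hC⟩
      simp only at hB hC
      subst hB hC
      obtain ⟨g, rfl, rfl⟩ := hΓ.exists_smul_arc hy h
      exact ⟨QuotientGroup.mk g, rfl⟩
    · rintro ⟨p, hp⟩
      induction p using QuotientGroup.induction_on with | _ g
      rw [← hp]
      exact ⟨g • x, g • y, hΓ.arc_smul g hy, rfl, rfl⟩
  · rintro _ _ ⟨x, y, h, rfl, rfl⟩
    exact hadj (hΓ.adj_of_mem _ _ h)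
  · intro B C hBC
    obtain ⟨x, y, h, ⟨rfl, rfl⟩ | ⟨rfl, rfl⟩⟩ := hEdge B C hBC
    · exact .inl ⟨⟨x, y, h, rfl, rfl⟩, hanti x y h⟩
    · exact .inr ⟨⟨x, y, h, rfl, rfl⟩, hanti x y h⟩

theorem nonempty_iso_quotient_quotient [T.Normal] {K : Subgroup G} {L : Subgroup (G ⧸ T)}
    (h : ∀ x y : V, orb L (orb T x) = orb L (orb T y) ↔ orb K x = orb K y) :
    Nonempty (normalQuotient (normalQuotient Γ T) L ≃g normalQuotient Γ K) := by
  let F : Orbits K V → Orbits L (Orbits T V) :=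
    Quotient.lift (fun x => orb L (orb T x)) fun x y hxy => (h x y).mpr (Quotient.sound hxy)
  have hF : ∀ x, F (orb K x) = orb L (orb T x) := fun _ => rfl
  have hinj : Function.Injective F := by
    intro B C
    induction B using Quotient.inductionOn
    induction C using Quotient.inductionOn
    exact fun e => (h _ _).mp e
  have hsurj : Function.Surjective F := by
    intro B
    induction B using Quotient.inductionOn with | _ X
    induction X using Quotient.inductionOn with | _ x
    exact ⟨orb K x, rfl⟩
  refine ⟨SimpleGraph.Iso.symm ⟨Equiv.ofBijective F ⟨hinj, hsurj⟩, ?_⟩⟩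
  intro B C
  change (normalQuotient (normalQuotient Γ T) L).Adj (F B) (F C) ↔ _
  constructor
  · rintro ⟨hne, -, -, ⟨-, x, y, hxy, rfl, rfl⟩, hB, hC⟩
    refine ⟨fun e => hne (congrArg F e), x, y, hxy, hinj ?_, hinj ?_⟩
    · rw [hF, hB]
    · rw [hF, hC]
  · rintro ⟨hne, x, y, hxy, rfl, rfl⟩
    refine ⟨fun e => hne (hinj e), orb T x, orb T y, ⟨fun e => hne (hinj ?_), x, y, hxy, rfl, rfl⟩,
      rfl, rfl⟩
    rw [hF, hF, e]

/-- Elements of `T` and of the orbit kernel keep every point in its `N`-orbit, so passing to `G ⧸ T`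
and enlarging `N` to its kernel merges no further points. -/
theorem orb_map_orbitKernel_iff [T.Normal] {N : Subgroup G} (hTN : T ≤ orbitKernel N V) (x y : V) :
    orb ((orbitKernel N V).map (QuotientGroup.mk' T)) (orb T x) =
      orb ((orbitKernel N V).map (QuotientGroup.mk' T)) (orb T y) ↔ orb N x = orb N y := by
  constructor
  · intro h
    obtain ⟨_, ⟨g, hg, rfl⟩, hq⟩ := exists_smul_of_orb_eq h
    have hq : orb T (g • x) = orb T y := hq
    obtain ⟨t, ht, rfl⟩ := exists_smul_of_orb_eq hq
    exact ((hTN ht _).trans (hg x)).symm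
  · intro h
    obtain ⟨n, hn, rfl⟩ := exists_smul_of_orb_eq h
    have hmem : (QuotientGroup.mk n : G ⧸ T) ∈ (orbitKernel N V).map (QuotientGroup.mk' T) :=
      ⟨n, le_orbitKernel N hn, rfl⟩
    exact (orb_smul_of_mem hmem (orb T x)).symm

/-- The labels induced on the `T`-orbits. -/
def quotientLabel {n : ℕ} (T : Subgroup G) (a : V → ZMod n)
    (h : ∀ x y, orb T x = orb T y → a x = a y) : Orbits T V → ZMod n :=
  Quotient.lift a fun x y hxy => h x y (Quotient.sound hxy)

theorem CycleLabel.quotientLabel [T.Normal] {n : ℕ} {c : V → ZMod n}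
    (hc : CycleLabel Γ G c) (h : ∀ x y, orb T x = orb T y → c x = c y)
    (hadj : ∀ x y, Γ.Adj x y → (normalQuotient Γ T).Adj (orb T x) (orb T y)) :
    CycleLabel (normalQuotient Γ T) (G ⧸ T) (quotientLabel T c h) where
  adj := by
    rintro _ _ ⟨-, x, y, hxy, rfl, rfl⟩
    exact hc.adj x y hxy
  up B := by
    induction B using Quotient.inductionOn with | _ x
    obtain ⟨y, hy, e⟩ := hc.up x
    exact ⟨orb T y, hadj x y hy, e⟩
  down B := by
    induction B using Quotient.inductionOn with | _ x
    obtain ⟨y, hy, e⟩ := hc.down x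
    exact ⟨orb T y, hadj x y hy, e⟩
  dihedral p := by
    induction p using QuotientGroup.induction_on with | _ g
    rcases hc.dihedral g with ⟨d, hd⟩ | ⟨d, hd⟩
    · refine .inl ⟨d, fun B => ?_⟩
      induction B using Quotient.inductionOn with | _ x
      exact hd x
    · refine .inr ⟨d, fun B => ?_⟩
      induction B using Quotient.inductionOn with | _ x
      exact hd x

theorem oriented_quotientLabel_iff {n : ℕ} {c : V → ZMod n}
    (h : ∀ x y, orb T x = orb T y → c x = c y) :
    Oriented (quotientArcs Δ T) (quotientLabel T c h) ↔ Oriented Δ c := by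
  constructor
  · rintro (h' | h')
    · exact .inl fun x y hxy => h' (orb T x) (orb T y) ⟨x, y, hxy, rfl, rfl⟩
    · exact .inr fun x y hxy => h' (orb T x) (orb T y) ⟨x, y, hxy, rfl, rfl⟩
  · rintro (h' | h')
    · left; rintro _ _ ⟨x, y, hxy, rfl, rfl⟩; exact h' x y hxy
    · right; rintro _ _ ⟨x, y, hxy, rfl, rfl⟩; exact h' x y hxy

end Quotients

/-! ### Recognizing a pair from its labels -/

section Recognition

variable {V : Type u} {G : Type v} [Group G] [MulAction G V] {Γ : SimpleGraph V} {Δ : Set (V × V)}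
  {r s : ℕ} {a : V → ZMod r} {b : V → ZMod s}

theorem perm_apply_inv {W : Type w} (p : Equiv.Perm W) (x : W) : p (p⁻¹ x) = x :=
  p.apply_symm_apply x

theorem perm_inv_apply {W : Type w} (p : Equiv.Perm W) (x : W) : p⁻¹ (p x) = x :=
  p.symm_apply_apply x

theorem ActsDihedrally.comp {W : Type w} {n : ℕ} {a : W → ZMod n} {p q : W → W}
    (hp : ActsDihedrally a p) (hq : ActsDihedrally a q) : ActsDihedrally a fun x => p (q x) := by
  rcases hp with ⟨c, hc⟩ | ⟨c, hc⟩ <;> rcases hq with ⟨d, hd⟩ | ⟨d, hd⟩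
  · exact .inl ⟨d + c, fun x => by rw [hc, hd]; ring⟩
  · exact .inr ⟨d + c, fun x => by rw [hc, hd]; ring⟩
  · exact .inr ⟨c - d, fun x => by rw [hc, hd]; ring⟩
  · exact .inl ⟨c - d, fun x => by rw [hc, hd]; ring⟩

/-- The permutations preserving the arcs `Δ` and acting dihedrally on the labels `a`. -/
def labelAut {W : Type w} {n : ℕ} (Δ : Set (W × W)) (a : W → ZMod n) :
    Subgroup (Equiv.Perm W) where
  carrier := {p | (∀ x y, (p x, p y) ∈ Δ ↔ (x, y) ∈ Δ) ∧ ActsDihedrally a p}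
  one_mem' := ⟨fun _ _ => Iff.rfl, .inl ⟨0, fun x => by simp⟩⟩
  mul_mem' hp hq := ⟨fun x y => (hp.1 _ _).trans (hq.1 x y), hp.2.comp hq.2⟩
  inv_mem' {p} hp := by
    refine ⟨fun x y => ?_, ?_⟩
    · have := hp.1 (p⁻¹ x) (p⁻¹ y)
      rw [perm_apply_inv, perm_apply_inv] at this
      exact this.symm
    · rcases hp.2 with ⟨c, hc⟩ | ⟨c, hc⟩
      · refine .inl ⟨-c, fun x => ?_⟩
        have := hc (p⁻¹ x)
        rw [perm_apply_inv] at this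
        linear_combination -this
      · refine .inr ⟨c, fun x => ?_⟩
        have := hc (p⁻¹ x)
        rw [perm_apply_inv] at this
        linear_combination this

theorem labelAut_fix_or_reflect {W : Type w} {n : ℕ} {Δ : Set (W × W)} {a : W → ZMod n}
    {p : Equiv.Perm W} (hp : p ∈ labelAut Δ a) {x : W} (hx : p x = x) :
    (∀ v, a (p v) = a v) ∨ ∀ v, a (p v) = 2 * a x - a v := by
  rcases hp.2 with ⟨c, hc⟩ | ⟨c, hc⟩
  · left; intro v
    have := hc x
    rw [hx] at this
    linear_combination hc v - this
  · right; intro v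
    have := hc x
    rw [hx] at this
    linear_combination hc v - this

/-- Rigidity for all permutations compatible with arcs and label, not only those from `G`. This
allows `G` to be compared with a model group inside one common overgroup. -/
theorem Bidirectional.labelAut_stabilizer (h : Bidirectional Δ a) (hΓ : IsOG4 Γ G Δ) (hr : 3 ≤ r)
    {p q : Equiv.Perm V} (hp : p ∈ labelAut Δ a) (hq : q ∈ labelAut Δ a) {x : V} (hpx : p x = x)
    (hqx : q x = x) (hq1 : q ≠ 1) : p = 1 ∨ p = q := by
  have key : ∀ p ∈ labelAut Δ a, p x = x → (∀ v, a (p v) = a v) → p = 1 := by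
    intro p hp hpx hpa
    ext v
    exact h.eq_self_of_fix hΓ hr (fun y z => (hp.1 y z).mpr) hpa hpx v
  rcases labelAut_fix_or_reflect hp hpx with hpa | hpa
  · exact .inl (key p hp hpx hpa)
  · right
    have hqa := (labelAut_fix_or_reflect hq hqx).resolve_left fun h => hq1 (key q hq hqx h)
    have h1 : p * q = 1 := key _ (mul_mem hp hq) (by simp [hpx, hqx]) fun v => by
      rw [Equiv.Perm.mul_apply, hpa, hqa]; ring
    have h2 : q * q = 1 := key _ (mul_mem hq hq) (by simp [hqx]) fun v => by
      rw [Equiv.Perm.mul_apply, hqa, hqa]; ring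
    exact mul_right_cancel (h1.trans h2.symm)

/-- Recognition of a pair by means of an explicit model of its arcs. -/
theorem pairIso_of_labels (hΓ : IsOG4 Γ G Δ) (hr : 3 ≤ r) (ha : CycleLabel Γ G a)
    (hA : Bidirectional Δ a) (x₀ : V) {W : Type w} {Γ' : SimpleGraph W}
    {K : Subgroup (Equiv.Perm W)} {Δ' : Set (W × W)} (a' : W → ZMod r) (F : V → W)
    (hF : Function.Bijective F) (hFa : ∀ x, a' (F x) = a x)
    (hout : ∀ x w, (F x, w) ∈ Δ' ↔ ∃ y, (x, y) ∈ Δ ∧ F y = w)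
    (hadj : ∀ x w, Γ'.Adj (F x) w ↔ ∃ y, Γ.Adj x y ∧ F y = w)
    (hK : K ≤ labelAut Δ' a') (hnbr : ∀ w, Γ'.Adj (F x₀) w → ∃ k ∈ K, k (F x₀) = w)
    (hstab : ∃ k ∈ K, k (F x₀) = F x₀ ∧ k ≠ 1) : PairIso Γ G Δ Γ' K Δ' := by
  let E : V ≃ W := Equiv.ofBijective F hF
  have hE : ∀ x, E x = F x := fun _ => rfl
  have hEs : ∀ w, F (E.symm w) = w := fun w => E.apply_symm_apply w
  have hΔ : ∀ x y, (F x, F y) ∈ Δ' ↔ (x, y) ∈ Δ := fun x y => by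
    rw [hout]
    exact ⟨fun ⟨z, hz, e⟩ => hF.1 e ▸ hz, fun h => ⟨y, h, rfl⟩⟩
  have hAdj : ∀ x y, Γ'.Adj (F x) (F y) ↔ Γ.Adj x y := fun x y => by
    rw [hadj]
    exact ⟨fun ⟨z, hz, e⟩ => hF.1 e ▸ hz, fun h => ⟨y, h, rfl⟩⟩
  -- The action of `G` transported along the bijection to the model; the goal is that its image is
  -- exactly `K`.
  let ρ : G →* Equiv.Perm W := MonoidHom.mk' (fun g => E.permCongr (MulAction.toPerm g)) (by
    intro g k; ext w; simp [mul_smul])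
  have hρ : ∀ g x, ρ g (F x) = F (g • x) := fun g x => by
    change E (g • E.symm (E x)) = _
    rw [E.symm_apply_apply, hE]
  have hρinj : ∀ g, ρ g = 1 → g = 1 := fun g h => hΓ.eq_one_of_smul_eq fun x => hF.1 (by
    rw [← hρ, h, Equiv.Perm.one_apply])
  have hρK : ∀ g, ρ g ∈ labelAut Δ' a' := by
    intro g
    refine ⟨fun w w' => ?_, ?_⟩
    · obtain ⟨x, rfl⟩ := hF.2 w
      obtain ⟨y, rfl⟩ := hF.2 w'
      rw [hρ, hρ, hΔ, hΔ]
      refine ⟨fun h => ?_, hΓ.arc_smul g⟩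
      simpa using hΓ.arc_smul g⁻¹ h
    · rcases ha.dihedral g with ⟨c, hc⟩ | ⟨c, hc⟩
      · refine .inl ⟨c, fun w => ?_⟩
        obtain ⟨x, rfl⟩ := hF.2 w
        rw [hρ, hFa, hFa, hc]
      · refine .inr ⟨c, fun w => ?_⟩
        obtain ⟨x, rfl⟩ := hF.2 w
        rw [hρ, hFa, hFa, hc]
  have hpull : ∀ p ∈ labelAut Δ' a', E.symm.permCongr p ∈ labelAut Δ a := by
    intro p hp
    have hp' : ∀ v, F (E.symm.permCongr p v) = p (F v) := fun v => hEs _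
    refine ⟨fun x y => ?_, ?_⟩
    · rw [← hΔ, hp', hp', hp.1, hΔ]
    · rcases hp.2 with ⟨c, hc⟩ | ⟨c, hc⟩
      · exact .inl ⟨c, fun x => by rw [← hFa, hp', hc, hFa]⟩
      · exact .inr ⟨c, fun x => by rw [← hFa, hp', hc, hFa]⟩
  have hrigid : ∀ p ∈ labelAut Δ' a', ∀ q ∈ labelAut Δ' a', p (F x₀) = F x₀ → q (F x₀) = F x₀ →
      q ≠ 1 → p = 1 ∨ p = q := by
    intro p hp q hq hpx hqx hq1
    have hx : ∀ p : Equiv.Perm W, p (F x₀) = F x₀ → E.symm.permCongr p x₀ = x₀ := fun p hp => by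
      change E.symm (p (F x₀)) = x₀
      rw [hp, ← hE, E.symm_apply_apply]
    have hinj := (Equiv.permCongr E.symm).injective
    have h1 : E.symm.permCongr 1 = 1 := by ext; simp
    rcases hA.labelAut_stabilizer hΓ hr (hpull p hp) (hpull q hq) (hx p hpx) (hx q hqx)
      (fun h => hq1 (hinj (h.trans h1.symm))) with h | h
    · exact .inl (hinj (h.trans h1.symm))
    · exact .inr (hinj h)
  -- `K` preserves adjacency, so reaching every neighbour of the base point suffices, by
  -- connectedness, to reach every vertex.
  have htrans : ∀ v, ∃ k ∈ K, k (F x₀) = F v := by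
    refine connected_induction hΓ.connected x₀ ⟨1, one_mem K, rfl⟩ ?_
    rintro v w hvw ⟨k, hk, hkv⟩
    have hAdj' : ∀ w w', Γ'.Adj w w' ↔ (w, w') ∈ Δ' ∨ (w', w) ∈ Δ' := by
      intro w w'
      obtain ⟨x, rfl⟩ := hF.2 w
      obtain ⟨y, rfl⟩ := hF.2 w'
      rw [hAdj, hΔ, hΔ, hΓ.adj_iff]
    have h1 : Γ'.Adj (F x₀) (k⁻¹ (F w)) := by
      have := (hAdj v w).mpr hvw
      rw [← hkv, hAdj'] at this
      have h2 := (hK hk).1 (F x₀) (k⁻¹ (F w))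
      have h3 := (hK hk).1 (k⁻¹ (F w)) (F x₀)
      rw [perm_apply_inv] at h2 h3
      rw [hAdj', ← h2, ← h3]
      exact this
    obtain ⟨k', hk', e⟩ := hnbr _ h1
    exact ⟨k * k', mul_mem hk hk', by
      rw [Equiv.Perm.mul_apply, e, perm_apply_inv]⟩
  obtain ⟨κ, hκ, hκx, hκ1⟩ := hstab
  -- An element of `K` with the same effect on the base point differs from `ρ g` by 1 or by `κ`,
  -- both in `K`.
  have hmem : ∀ g, ρ g ∈ K := by
    intro g
    obtain ⟨k, hk, hkx⟩ := htrans (g • x₀)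
    have hp := hrigid (k⁻¹ * ρ g) (mul_mem (inv_mem (hK hk)) (hρK g)) κ (hK hκ)
      (by rw [Equiv.Perm.mul_apply, hρ, ← hkx, perm_inv_apply]) hκx hκ1
    rcases hp with hp | hp
    · rwa [← inv_mul_eq_one.mp hp]
    · rw [inv_mul_eq_iff_eq_mul.mp hp]
      exact mul_mem hk hκ
  -- The same comparison with the roles exchanged: the reflection `t` in `G` plays the part of `κ`.
  have hsurj : ∀ k ∈ K, ∃ g, ρ g = k := by
    intro k hk
    obtain ⟨t, ht, hta⟩ := hA.exists_reflect hΓ hr ha x₀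
    have ht1 : ρ t ≠ 1 := fun h => by
      obtain rfl := hρinj t h
      obtain ⟨y, hy, e⟩ := hA.out_up x₀
      have := hta y
      rw [one_smul] at this
      exact two_ne_zero_zmod hr (by linear_combination this - 2 * e)
    obtain ⟨v, hv⟩ := hF.2 (k (F x₀))
    obtain ⟨g, hg⟩ := hΓ.exists_smul_eq x₀ v
    have hp := hrigid ((ρ g)⁻¹ * k) (mul_mem (inv_mem (hρK g)) (hK hk)) (ρ t) (hρK t)
      (by rw [Equiv.Perm.mul_apply, ← hv, ← hg, ← hρ, perm_inv_apply])
      (by rw [hρ, ht]) ht1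
    rcases hp with hp | hp
    · exact ⟨g, inv_mul_eq_one.mp hp⟩
    · exact ⟨g * t, by rw [map_mul, inv_mul_eq_iff_eq_mul.mp hp]⟩
  let φ : G ≃* K := MulEquiv.ofBijective (ρ.codRestrict K hmem) ⟨by
    rw [injective_iff_map_eq_one]
    exact fun g hg => hρinj g (congrArg Subtype.val hg), by
    rintro ⟨k, hk⟩
    obtain ⟨g, rfl⟩ := hsurj k hk
    exact ⟨g, rfl⟩⟩
  exact ⟨⟨E, fun {x y} => hAdj x y⟩, φ, fun g x => (hρ g x).symm, fun x y => (hΔ x y).symm⟩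

/-- All four label directions are realized by neighbours. -/
theorem exists_adj_label (hΓ : IsOG4 Γ G Δ) (ha : CycleLabel Γ G a) (hb : CycleLabel Γ G b)
    (hinj : ∀ x w w', Γ.Adj x w → Γ.Adj x w' → a w = a w' → b w = b w' → w = w') (x : V)
    {i : ZMod r} {j : ZMod s} (hi : i = a x + 1 ∨ i = a x - 1) (hj : j = b x + 1 ∨ j = b x - 1) :
    ∃ y, Γ.Adj x y ∧ a y = i ∧ b y = j := by
  have hcard : ((fun w => (a w, b w)) '' Γ.neighborSet x).ncard = 4 := by
    rw [Set.InjOn.ncard_image, hΓ.valency]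
    intro w hw w' hw' h
    rw [Prod.mk.injEq] at h
    exact hinj x w w' hw hw' h.1 h.2
  have hsub : (fun w => (a w, b w)) '' Γ.neighborSet x ⊆
      {(a x + 1, b x + 1), (a x + 1, b x - 1), (a x - 1, b x + 1), (a x - 1, b x - 1)} := by
    rintro _ ⟨w, hw, rfl⟩
    rcases ha.adj x w hw with h | h <;> rcases hb.adj x w hw with h' | h' <;> simp [h, h']
  have hle : ({(a x + 1, b x + 1), (a x + 1, b x - 1), (a x - 1, b x + 1), (a x - 1, b x - 1)} :
      Set (ZMod r × ZMod s)).ncard ≤ 4 := by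
    refine (Set.ncard_insert_le _ _).trans (Nat.succ_le_succ ?_)
    refine (Set.ncard_insert_le _ _).trans (Nat.succ_le_succ ?_)
    refine (Set.ncard_insert_le _ _).trans (Nat.succ_le_succ ?_)
    rw [Set.ncard_singleton]
  have heq := Set.eq_of_subset_of_ncard_le hsub (hle.trans hcard.ge)
  have hmem : (i, j) ∈ (fun w => (a w, b w)) '' Γ.neighborSet x := by
    rw [heq]
    rcases hi with rfl | rfl <;> rcases hj with rfl | rfl <;> simp
  obtain ⟨y, hy, e⟩ := hmem
  rw [Prod.mk.injEq] at e
  exact ⟨y, hy, e.1, e.2⟩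

theorem exists_of_steps {A : Type w} [AddCommGroup A] {ℓ : V → A} {t u : A}
    (h₁ : ∀ v, ∃ w, ℓ w = ℓ v + t) (h₂ : ∀ v, ∃ w, ℓ w = ℓ v - t)
    (h₃ : ∀ v, ∃ w, ℓ w = ℓ v + u) (h₄ : ∀ v, ∃ w, ℓ w = ℓ v - u) (x : V) (p q : ℤ) :
    ∃ v, ℓ v = ℓ x + p • t + q • u := by
  have key : ∀ t : A, (∀ v, ∃ w, ℓ w = ℓ v + t) → (∀ v, ∃ w, ℓ w = ℓ v - t) →
      ∀ (x : V) (p : ℤ), ∃ v, ℓ v = ℓ x + p • t := by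
    intro t h h' x p
    induction p using Int.induction_on with
    | zero => exact ⟨x, by simp⟩
    | succ k ih =>
      obtain ⟨v, hv⟩ := ih
      obtain ⟨w, hw⟩ := h v
      exact ⟨w, by rw [hw, hv, add_smul, one_smul, add_assoc]⟩
    | pred k ih =>
      obtain ⟨v, hv⟩ := ih
      obtain ⟨w, hw⟩ := h' v
      exact ⟨w, by rw [hw, hv, sub_smul, one_smul, add_sub_assoc]⟩
  obtain ⟨v, hv⟩ := key t h₁ h₂ x p
  obtain ⟨w, hw⟩ := key u h₃ h₄ v q
  exact ⟨w, by rw [hw, hv]⟩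

/-- With `m = n + 2q`, `n + q` steps `(1, 1)` and `q` steps `(1, -1)` lead from `(0, 0)` to `(m,
n)`. The additional label `e` grows by `c` at each step, forward or backward, so it ends at `m * c`;
the choice `c = 0` ignores it. -/
theorem exists_label_of_even (hΓ : IsOG4 Γ G Δ) (ha : CycleLabel Γ G a) (hb : CycleLabel Γ G b)
    (hinj : ∀ x w w', Γ.Adj x w → Γ.Adj x w' → a w = a w' → b w = b w' → w = w') {x₀ : V}
    (hax : a x₀ = 0) (hbx : b x₀ = 0) {e : V → ZMod 2} {c : ZMod 2}
    (he : ∀ x y, Γ.Adj x y → e y = e x + c) (hex : e x₀ = 0) {m n : ℤ} (h : Even (m - n)) :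
    ∃ v, a v = m ∧ b v = n ∧ e v = m * c := by
  have hneg : ∀ δ c : ZMod 2, δ + c = δ - c := by decide
  have step : ∀ v (i : ZMod r) (j : ZMod s), (i = a v + 1 ∨ i = a v - 1) →
      (j = b v + 1 ∨ j = b v - 1) → ∃ w, a w = i ∧ b w = j ∧ e w = e v + c := by
    intro v i j hi hj
    obtain ⟨w, hw, h1, h2⟩ := exists_adj_label hΓ ha hb hinj v hi hj
    exact ⟨w, h1, h2, he _ _ hw⟩
  obtain ⟨q, hq⟩ := h
  have := exists_of_steps (ℓ := fun v => (a v, b v, e v))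
    (t := ((1 : ZMod r), (1 : ZMod s), c))
    (u := ((1 : ZMod r), (-1 : ZMod s), c)) (by
      intro v
      obtain ⟨w, h1, h2, h3⟩ := step v _ _ (.inl rfl) (.inl rfl)
      exact ⟨w, by simp [h1, h2, h3]⟩) (by
      intro v
      obtain ⟨w, h1, h2, h3⟩ := step v _ _ (.inr rfl) (.inr rfl)
      exact ⟨w, by simp [h1, h2, h3, hneg _ c]⟩) (by
      intro v
      obtain ⟨w, h1, h2, h3⟩ := step v _ _ (.inl rfl) (.inr rfl)
      exact ⟨w, by simp [h1, h2, h3, sub_eq_add_neg]⟩) (by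
      intro v
      obtain ⟨w, h1, h2, h3⟩ := step v _ _ (.inr rfl) (.inl rfl)
      exact ⟨w, by simp [h1, h2, h3, hneg _ c]⟩) x₀ (n + q) q
  obtain ⟨v, hv⟩ := this
  simp only [hax, hbx, hex, Prod.smul_mk, Prod.mk_add_mk, Prod.mk.injEq, zsmul_eq_mul, mul_one,
    zero_add, mul_neg] at hv
  have hm : m = n + q + q := by linarith
  refine ⟨v, ?_, ?_, ?_⟩
  · rw [hv.1, hm]; push_cast; ring
  · rw [hv.2.1]; push_cast; ring
  · rw [hv.2.2, hm]; push_cast; ring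

end Recognition

/-! ### The model groups: invariance of arcs, and reaching the neighbours of the origin -/

section Models

variable {r s : ℕ}

theorem mu_apply (p : X r s) : mu r s p = (p.1 + 1, p.2) := rfl

theorem nu_apply (p : X r s) : nu r s p = (p.1, p.2 + 1) := rfl

theorem sigma_apply (p : X r s) : sigma r s p = (-p.1, p.2) := rfl

theorem tau_apply (p : X r s) : tau r s p = (-p.1, -p.2) := rfl

/-- Reduction modulo 2 on `ℤ_n` for even `n`. -/
abbrev parity {n : ℕ} (hn : Even n) : ZMod n →+* ZMod 2 := ZMod.castHom hn.two_dvd (ZMod 2)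

theorem parity_eq_natCast_val {n : ℕ} [NeZero n] (hn : Even n) (i : ZMod n) :
    parity hn i = (i.val : ZMod 2) := by
  rw [parity, ZMod.castHom_apply, ZMod.cast_eq_val]

theorem even_val_iff {n : ℕ} [NeZero n] (hn : Even n) (i : ZMod n) :
    Even i.val ↔ parity hn i = 0 := by
  rw [parity_eq_natCast_val, ZMod.natCast_eq_zero_iff, even_iff_two_dvd]

theorem mem_Xplus_iff [NeZero r] [NeZero s] (hr : Even r) (hs : Even s) (p : X r s) :
    p ∈ Xplus r s ↔ parity hr p.1 = parity hs p.2 := by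
  change (Even p.1.val ↔ Even p.2.val) ↔ _
  rw [even_val_iff hr, even_val_iff hs]
  generalize parity hr p.1 = δ
  generalize parity hs p.2 = δ'
  revert δ δ'
  decide

theorem sgn_eq_sgnTwo [NeZero s] (hs : Even s) (j : ZMod s) : sgn j = sgnTwo s (parity hs j) := by
  rw [parity_eq_natCast_val, sgn, sgnTwo, ZMod.val_natCast, neg_one_pow_eq_pow_mod_two]

theorem sgn_add_one [NeZero s] (hs : Even s) (j : ZMod s) : sgn (j + 1) = -sgn j := by
  rw [sgn_eq_sgnTwo hs, sgn_eq_sgnTwo hs, map_add, map_one, sgnTwo_add_one]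

theorem sgn_neg [NeZero s] (hs : Even s) (j : ZMod s) : sgn (-j) = sgn j := by
  rw [sgn_eq_sgnTwo hs, sgn_eq_sgnTwo hs, map_neg]
  congr 1
  generalize parity hs j = δ
  revert δ
  decide

theorem mem_arcsH {p q : X r s} : (p, q) ∈ arcsH r s ↔
    (q.1 = p.1 + 1 ∧ q.2 = p.2 + sgn p.2) ∨ (q.1 = p.1 - 1 ∧ q.2 = p.2 - sgn p.2) := by
  simp only [arcsH, Set.mem_ofPred_eq, Prod.ext_iff]

theorem mem_arcsG {p q : X r s} : (p, q) ∈ arcsG r s ↔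
    (q.1 = p.1 + 1 ∨ q.1 = p.1 - 1) ∧ q.2 = p.2 + 1 := Iff.rfl

theorem mem_arcs2 {p q : X r s × ZMod 2} : (p, q) ∈ arcs2 r s ↔ q.2 = p.2 + 1 ∧
    ((q.1.1 = p.1.1 + 1 ∧ q.1.2 = p.1.2 + sgnTwo s p.2) ∨
      (q.1.1 = p.1.1 - 1 ∧ q.1.2 = p.1.2 - sgnTwo s p.2)) := by
  simp only [arcs2, sgnTwo, Set.mem_ofPred_eq, Prod.ext_iff]
  tauto

/-- Permutations preserving `Δ` and acting dihedrally on both coordinates. -/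
def coordAut {r s : ℕ} {W : Type w} (Δ : Set (W × W)) (π : W → X r s) :
    Subgroup (Equiv.Perm W) :=
  labelAut Δ (fun p => (π p).1) ⊓ labelAut Δ (fun p => (π p).2)

theorem mem_coordAut_of_preserves {W : Type w} {Δ : Set (W × W)} {π : W → X r s}
    {p : Equiv.Perm W} (h : ∀ x y, (p x, p y) ∈ Δ ↔ (x, y) ∈ Δ)
    (h₁ : ActsDihedrally (fun x => (π x).1) p) (h₂ : ActsDihedrally (fun x => (π x).2) p) :
    p ∈ coordAut Δ π := ⟨⟨h, h₁⟩, ⟨h, h₂⟩⟩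

theorem mu_mem_arcsG : mu r s ∈ coordAut (arcsG r s) id := by
  refine mem_coordAut_of_preserves (fun p q => ?_) (.inl ⟨1, fun p => rfl⟩)
    (.inl ⟨0, fun p => by simp [mu_apply]⟩)
  simp only [mem_arcsG, mu_apply]
  grind

theorem nu_mem_arcsG : nu r s ∈ coordAut (arcsG r s) id := by
  refine mem_coordAut_of_preserves (fun p q => ?_) (.inl ⟨0, fun p => by simp [nu_apply]⟩)
    (.inl ⟨1, fun p => rfl⟩)
  simp only [mem_arcsG, nu_apply]
  grind

theorem sigma_mem_arcsG : sigma r s ∈ coordAut (arcsG r s) id := by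
  refine mem_coordAut_of_preserves (fun p q => ?_) (.inr ⟨0, fun p => by simp [sigma_apply]⟩)
    (.inl ⟨0, fun p => by simp [sigma_apply]⟩)
  simp only [mem_arcsG, sigma_apply]
  grind

theorem mu_mem_arcsH : mu r s ∈ coordAut (arcsH r s) id := by
  refine mem_coordAut_of_preserves (fun p q => ?_) (.inl ⟨1, fun p => rfl⟩)
    (.inl ⟨0, fun p => by simp [mu_apply]⟩)
  simp only [mem_arcsH, mu_apply]
  grind

theorem nu_mul_sigma_mem_arcsH [NeZero s] (hs : Even s) :
    nu r s * sigma r s ∈ coordAut (arcsH r s) id := by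
  refine mem_coordAut_of_preserves (fun p q => ?_)
    (.inr ⟨0, fun p => by simp [sigma_apply, nu_apply]⟩)
    (.inl ⟨1, fun p => by simp [sigma_apply, nu_apply]⟩)
  simp only [mem_arcsH, Equiv.Perm.mul_apply, nu_apply, sigma_apply, sgn_add_one hs]
  grind

theorem tau_mem_arcsH [NeZero s] (hs : Even s) : tau r s ∈ coordAut (arcsH r s) id := by
  refine mem_coordAut_of_preserves (fun p q => ?_)
    (.inr ⟨0, fun p => by simp [tau_apply]⟩) (.inr ⟨0, fun p => by simp [tau_apply]⟩)
  simp only [mem_arcsH, tau_apply, sgn_neg hs]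
  grind

theorem Grp_le_coordAut : Grp r s ≤ coordAut (arcsG r s) id := by
  refine (Subgroup.closure_le _).mpr ?_
  rintro p (rfl | rfl | rfl)
  · exact mu_mem_arcsG
  · exact nu_mem_arcsG
  · exact sigma_mem_arcsG

theorem Hrp_le_coordAut [NeZero s] (hs : Even s) : Hrp r s ≤ coordAut (arcsH r s) id := by
  refine (Subgroup.closure_le _).mpr ?_
  rintro p (rfl | rfl | rfl)
  · exact mu_mem_arcsH
  · exact nu_mul_sigma_mem_arcsH hs
  · exact tau_mem_arcsH hs

theorem restrict_mem_coordAut {Δ : Set (X r s × X r s)} {g : Equiv.Perm (Xplus r s)}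
    {h : Equiv.Perm (X r s)} (hh : h ∈ coordAut Δ id) (hg : ∀ p : Xplus r s, (g p : X r s) = h p) :
    g ∈ coordAut (arcsPlus Δ) (Subtype.val : Xplus r s → X r s) := by
  refine mem_coordAut_of_preserves (fun p q => ?_) ?_ ?_
  · change ((g p : X r s), (g q : X r s)) ∈ Δ ↔ ((p : X r s), (q : X r s)) ∈ Δ
    rw [hg, hg]
    exact hh.1.1 _ _
  · rcases hh.1.2 with ⟨c, hc⟩ | ⟨c, hc⟩
    · exact .inl ⟨c, fun p => by simp only [hg]; exact hc p⟩
    · exact .inr ⟨c, fun p => by simp only [hg]; exact hc p⟩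
  · rcases hh.2.2 with ⟨c, hc⟩ | ⟨c, hc⟩
    · exact .inl ⟨c, fun p => by simp only [hg]; exact hc p⟩
    · exact .inr ⟨c, fun p => by simp only [hg]; exact hc p⟩

theorem GrpPlus_le_coordAut :
    GrpPlus r s ≤ coordAut (arcsPlus (arcsG r s)) (Subtype.val : Xplus r s → X r s) := by
  refine (Subgroup.closure_le _).mpr ?_
  rintro g ⟨h, rfl | rfl | rfl, hg⟩
  · exact restrict_mem_coordAut (pow_mem mu_mem_arcsG 2) hg
  · exact restrict_mem_coordAut (mul_mem nu_mem_arcsG mu_mem_arcsG) hg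
  · exact restrict_mem_coordAut sigma_mem_arcsG hg

theorem HrpPlus_le_coordAut [NeZero s] (hs : Even s) :
    HrpPlus r s ≤ coordAut (arcsPlus (arcsH r s)) (Subtype.val : Xplus r s → X r s) := by
  refine (Subgroup.closure_le _).mpr ?_
  rintro g ⟨h, rfl | rfl | rfl, hg⟩
  · exact restrict_mem_coordAut (pow_mem mu_mem_arcsH 2) hg
  -- `μ` and `ν` commute, so this generator is a product of generators already treated for `Hrp`.
  · have : nu r s * mu r s * sigma r s = mu r s * (nu r s * sigma r s) := by
      ext p <;> rfl
    rw [this] at hg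
    exact restrict_mem_coordAut (mul_mem mu_mem_arcsH (nu_mul_sigma_mem_arcsH hs)) hg
  · exact restrict_mem_coordAut (tau_mem_arcsH hs) hg

theorem Grp2_le_coordAut :
    Grp2 r s ≤ coordAut (arcs2 r s) (Prod.fst : X r s × ZMod 2 → X r s) := by
  refine (Subgroup.closure_le _).mpr ?_
  rintro p (rfl | rfl | rfl | rfl)
  · refine mem_coordAut_of_preserves (fun p q => ?_) (.inl ⟨1, fun p => rfl⟩)
      (.inl ⟨0, fun p => by simp [mu_apply]⟩)
    simp only [mem_arcs2, Equiv.prodCongr_apply, Prod.map, mu_apply, Equiv.refl_apply]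
    grind
  · refine mem_coordAut_of_preserves (fun p q => ?_) (.inl ⟨0, fun p => by simp [nu_apply]⟩)
      (.inl ⟨1, fun p => rfl⟩)
    simp only [mem_arcs2, Equiv.prodCongr_apply, Prod.map, nu_apply, Equiv.refl_apply]
    grind
  · refine mem_coordAut_of_preserves (fun p q => ?_) (.inl ⟨0, fun p => by simp [sigma2]⟩)
      (.inr ⟨0, fun p => by simp [sigma2]⟩)
    simp only [mem_arcs2, sigma2, Equiv.prodCongr_apply, Prod.map, Equiv.refl_apply,
      Equiv.neg_apply, Equiv.coe_addRight, sgnTwo_add_one, add_left_inj]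
    grind
  · refine mem_coordAut_of_preserves (fun p q => ?_) (.inr ⟨0, fun p => by simp [tau_apply]⟩)
      (.inr ⟨0, fun p => by simp [tau_apply]⟩)
    simp only [mem_arcs2, Equiv.prodCongr_apply, Prod.map, tau_apply, Equiv.refl_apply]
    grind

/-- `w` lies in the orbit of `w₀` under `K`. -/
def Reaches {W : Type w} (K : Subgroup (Equiv.Perm W)) (w₀ w : W) : Prop := ∃ k ∈ K, k w₀ = w

namespace Reaches

variable {W : Type w} {K : Subgroup (Equiv.Perm W)} {w₀ w w' : W} {k : Equiv.Perm W}

theorem refl (K : Subgroup (Equiv.Perm W)) (w₀ : W) : Reaches K w₀ w₀ := ⟨1, one_mem K, rfl⟩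

theorem apply (hk : k ∈ K) (h : Reaches K w₀ w) (e : k w = w') : Reaches K w₀ w' := by
  obtain ⟨l, hl, rfl⟩ := h
  exact ⟨k * l, mul_mem hk hl, e⟩

theorem of_apply (hk : k ∈ K) (h : Reaches K w₀ w) (e : k w' = w) : Reaches K w₀ w' :=
  h.apply (inv_mem hk) (by rw [← e, perm_inv_apply])

end Reaches

theorem Gam_adj_zero {w : X r s} (h : (Gam r s).Adj (0, 0) w) :
    w = (1, 1) ∨ w = (1, -1) ∨ w = (-1, 1) ∨ w = (-1, -1) := by
  obtain ⟨-, h1 | h1, h2 | h2⟩ := h <;> simp only [zero_add, zero_sub] at h1 h2 <;>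
    simp [Prod.ext_iff, h1, h2]

theorem reaches_Grp {w : X r s} (h : (Gam r s).Adj (0, 0) w) : Reaches (Grp r s) (0, 0) w := by
  have hmu : mu r s ∈ Grp r s := Subgroup.subset_closure (by simp)
  have hnu : nu r s ∈ Grp r s := Subgroup.subset_closure (by simp)
  have h1 : Reaches (Grp r s) (0, 0) (0, 1) := (Reaches.refl _ _).apply hnu (by simp [nu_apply])
  have h2 : Reaches (Grp r s) (0, 0) (0, -1) :=
    (Reaches.refl _ _).of_apply hnu (by simp [nu_apply])
  rcases Gam_adj_zero h with rfl | rfl | rfl | rfl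
  · exact h1.apply hmu (by simp [mu_apply])
  · exact h2.apply hmu (by simp [mu_apply])
  · exact h1.of_apply hmu (by simp [mu_apply])
  · exact h2.of_apply hmu (by simp [mu_apply])

theorem reaches_Hrp {w : X r s} (h : (Gam r s).Adj (0, 0) w) : Reaches (Hrp r s) (0, 0) w := by
  have hmu : mu r s ∈ Hrp r s := Subgroup.subset_closure (by simp)
  have hnu : nu r s * sigma r s ∈ Hrp r s := Subgroup.subset_closure (by simp)
  have htau : tau r s ∈ Hrp r s := Subgroup.subset_closure (by simp)
  have h1 : Reaches (Hrp r s) (0, 0) (0, 1) :=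
    (Reaches.refl _ _).apply hnu (by simp [nu_apply, sigma_apply])
  have h2 : Reaches (Hrp r s) (0, 0) (1, 1) := h1.apply hmu (by simp [mu_apply])
  have h3 : Reaches (Hrp r s) (0, 0) (-1, 1) := h1.of_apply hmu (by simp [mu_apply])
  rcases Gam_adj_zero h with rfl | rfl | rfl | rfl
  · exact h2
  · exact h3.apply htau (by simp [tau_apply])
  · exact h3
  · exact h2.apply htau (by simp [tau_apply])

theorem exists_restriction {h : Equiv.Perm (X r s)}
    (hh : ∀ p, h p ∈ Xplus r s ↔ p ∈ Xplus r s) :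
    ∃ g : Equiv.Perm (Xplus r s), ∀ p : Xplus r s, (g p : X r s) = h p :=
  ⟨h.subtypePerm hh, fun _ => rfl⟩

theorem exists_mem_GrpPlus [NeZero r] [NeZero s] (hr : Even r) (hs : Even s) :
    (∃ g ∈ GrpPlus r s, ∀ p : Xplus r s, (g p : X r s) = (p.1.1 + 1, p.1.2 + 1)) ∧
      ∃ g ∈ GrpPlus r s, ∀ p : Xplus r s, (g p : X r s) = (-p.1.1, p.1.2) := by
  have hneg : ∀ δ : ZMod 2, -δ = δ := by decide
  constructor
  · obtain ⟨g, hg⟩ := exists_restriction (h := nu r s * mu r s) fun p => by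
      simp only [Equiv.Perm.mul_apply, mem_Xplus_iff hr hs, mu_apply, nu_apply, map_add, map_one,
        add_left_inj]
    exact ⟨g, Subgroup.subset_closure ⟨_, by simp, hg⟩, hg⟩
  · obtain ⟨g, hg⟩ := exists_restriction (h := sigma r s) fun p => by
      simp only [mem_Xplus_iff hr hs, sigma_apply, map_neg, hneg]
    exact ⟨g, Subgroup.subset_closure ⟨_, by simp, hg⟩, hg⟩

theorem exists_mem_HrpPlus [NeZero r] [NeZero s] (hr : Even r) (hs : Even s) :
    (∃ g ∈ HrpPlus r s, ∀ p : Xplus r s, (g p : X r s) = (p.1.1 + 2, p.1.2)) ∧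
      (∃ g ∈ HrpPlus r s, ∀ p : Xplus r s, (g p : X r s) = (-p.1.1 + 1, p.1.2 + 1)) ∧
      ∃ g ∈ HrpPlus r s, ∀ p : Xplus r s, (g p : X r s) = (-p.1.1, -p.1.2) := by
  have hneg : ∀ δ : ZMod 2, -δ = δ := by decide
  have htwo : ∀ δ : ZMod 2, δ + 1 + 1 = δ := by decide
  refine ⟨?_, ?_, ?_⟩
  · obtain ⟨g, hg⟩ := exists_restriction (h := mu r s ^ 2) fun p => by
      simp only [pow_two, Equiv.Perm.mul_apply, mem_Xplus_iff hr hs, mu_apply, map_add, map_one,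
        htwo]
    refine ⟨g, Subgroup.subset_closure ⟨_, by simp, hg⟩, fun p => ?_⟩
    rw [hg]
    simp only [pow_two, Equiv.Perm.mul_apply, mu_apply]
    ring_nf
  · obtain ⟨g, hg⟩ := exists_restriction (h := nu r s * mu r s * sigma r s) fun p => by
      simp only [Equiv.Perm.mul_apply, mem_Xplus_iff hr hs, mu_apply, nu_apply, sigma_apply,
        map_add, map_one, map_neg, hneg, add_left_inj]
    exact ⟨g, Subgroup.subset_closure ⟨_, by simp, hg⟩, hg⟩
  · obtain ⟨g, hg⟩ := exists_restriction (h := tau r s) fun p => by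
      simp only [mem_Xplus_iff hr hs, tau_apply, map_neg, hneg]
    exact ⟨g, Subgroup.subset_closure ⟨_, by simp, hg⟩, hg⟩

theorem one_one_mem_Xplus [NeZero r] [NeZero s] (hr : Even r) (hs : Even s) :
    ((1, 1) : X r s) ∈ Xplus r s := by
  rw [mem_Xplus_iff hr hs, map_one, map_one]

theorem neg_one_one_mem_Xplus [NeZero r] [NeZero s] (hr : Even r) (hs : Even s) :
    ((-1, 1) : X r s) ∈ Xplus r s := by
  rw [mem_Xplus_iff hr hs, map_neg, map_one, map_one]
  rfl

theorem neg_one_neg_one_mem_Xplus [NeZero r] [NeZero s] (hr : Even r) (hs : Even s) :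
    ((-1, -1) : X r s) ∈ Xplus r s := by
  rw [mem_Xplus_iff hr hs, map_neg, map_one, map_neg, map_one]

theorem reaches_GrpPlus [NeZero r] [NeZero s] (hr : Even r) (hs : Even s) {w₀ w : Xplus r s}
    (hw₀ : (w₀ : X r s) = (0, 0)) (h : (GamPlus r s).Adj w₀ w) : Reaches (GrpPlus r s) w₀ w := by
  obtain ⟨⟨g, hg, eg⟩, ⟨t, ht, et⟩⟩ := exists_mem_GrpPlus hr hs
  have h' : (Gam r s).Adj (0, 0) w := hw₀ ▸ h
  have h1 : Reaches (GrpPlus r s) w₀ ⟨(1, 1), one_one_mem_Xplus hr hs⟩ :=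
    (Reaches.refl _ _).apply hg (Subtype.ext (by rw [eg, hw₀]; simp))
  have h2 : Reaches (GrpPlus r s) w₀ ⟨(-1, -1), neg_one_neg_one_mem_Xplus hr hs⟩ :=
    (Reaches.refl _ _).of_apply hg (Subtype.ext (by rw [eg, hw₀]; simp))
  rcases Gam_adj_zero h' with e | e | e | e
  · exact h1.apply (one_mem _) (Subtype.ext e.symm)
  · exact h2.apply ht (Subtype.ext (by rw [et, e]; simp))
  · exact h1.apply ht (Subtype.ext (by rw [et, e]))
  · exact h2.apply (one_mem _) (Subtype.ext e.symm)

theorem reaches_HrpPlus [NeZero r] [NeZero s] (hr : Even r) (hs : Even s) {w₀ w : Xplus r s}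
    (hw₀ : (w₀ : X r s) = (0, 0)) (h : (GamPlus r s).Adj w₀ w) : Reaches (HrpPlus r s) w₀ w := by
  obtain ⟨⟨m, hm, em⟩, ⟨g, hg, eg⟩, ⟨t, ht, et⟩⟩ := exists_mem_HrpPlus hr hs
  have h' : (Gam r s).Adj (0, 0) w := hw₀ ▸ h
  have h1 : Reaches (HrpPlus r s) w₀ ⟨(1, 1), one_one_mem_Xplus hr hs⟩ :=
    (Reaches.refl _ _).apply hg (Subtype.ext (by rw [eg, hw₀]; simp))
  have h2 : Reaches (HrpPlus r s) w₀ ⟨(-1, 1), neg_one_one_mem_Xplus hr hs⟩ :=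
    h1.of_apply hm (Subtype.ext (by rw [em]; ring_nf))
  rcases Gam_adj_zero h' with e | e | e | e
  · exact h1.apply (one_mem _) (Subtype.ext e.symm)
  · exact h2.apply ht (Subtype.ext (by rw [et, e]; simp))
  · exact h2.apply (one_mem _) (Subtype.ext e.symm)
  · exact h1.apply ht (Subtype.ext (by rw [et, e]))

theorem reaches_Grp2 {w : X r s × ZMod 2} (h : (Gam2 r s).Adj ((0, 0), 0) w) :
    Reaches (Grp2 r s) ((0, 0), 0) w := by
  have hmu : (mu r s).prodCongr (Equiv.refl (ZMod 2)) ∈ Grp2 r s :=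
    Subgroup.subset_closure (by simp)
  have hnu : (nu r s).prodCongr (Equiv.refl (ZMod 2)) ∈ Grp2 r s :=
    Subgroup.subset_closure (by simp)
  have hsi : sigma2 r s ∈ Grp2 r s := Subgroup.subset_closure (by simp)
  have h0 : Reaches (Grp2 r s) ((0, 0), 0) ((0, 0), 1) :=
    (Reaches.refl _ _).apply hsi (by simp [sigma2])
  have h1 : Reaches (Grp2 r s) ((0, 0), 0) ((0, 1), 1) := h0.apply hnu (by simp [nu_apply])
  have h2 : Reaches (Grp2 r s) ((0, 0), 0) ((0, -1), 1) := h0.of_apply hnu (by simp [nu_apply])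
  obtain ⟨w, δ⟩ := w
  obtain ⟨hδ, hw⟩ := h
  obtain rfl : δ = 1 := (zmod_two_cases δ).resolve_left (Ne.symm hδ)
  rcases Gam_adj_zero hw with rfl | rfl | rfl | rfl
  · exact h1.apply hmu (by simp [mu_apply])
  · exact h2.apply hmu (by simp [mu_apply])
  · exact h1.of_apply hmu (by simp [mu_apply])
  · exact h2.of_apply hmu (by simp [mu_apply])

/-- Adding the odd modulus to a representative changes its parity. -/
theorem exists_intCast_eq_of_odd (hr : Odd r) (i : ZMod r) (n : ℤ) :
    ∃ m : ℤ, (m : ZMod r) = i ∧ Even (m - n) := by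
  have : NeZero r := ⟨by rintro rfl; simp at hr⟩
  by_cases h : Even ((i.val : ℤ) - n)
  · exact ⟨i.val, by simp, h⟩
  · refine ⟨i.val + r, by simp, ?_⟩
    rw [Int.not_even_iff_odd] at h
    have hr' : Odd (r : ℤ) := by exact_mod_cast hr
    have := h.add_odd hr'
    rwa [show (i.val : ℤ) - n + r = i.val + r - n by ring] at this

end Models

/-! ### Labels as coordinates, and the six lines of the table -/

section Classification

variable {V : Type u} {G : Type v} [Group G] [MulAction G V] {Γ : SimpleGraph V} {Δ : Set (V × V)}
  {r s : ℕ} {a : V → ZMod r} {b : V → ZMod s}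

theorem Gam_adj_iff_exists (hΓ : IsOG4 Γ G Δ) (hr : 3 ≤ r) (ha : CycleLabel Γ G a)
    (hb : CycleLabel Γ G b)
    (hinj : ∀ x w w', Γ.Adj x w → Γ.Adj x w' → a w = a w' → b w = b w' → w = w') (x : V)
    (w : X r s) : (Gam r s).Adj (a x, b x) w ↔ ∃ y, Γ.Adj x y ∧ (a y, b y) = w := by
  constructor
  · rintro ⟨-, h1, h2⟩
    obtain ⟨y, hy, e, f⟩ := exists_adj_label hΓ ha hb hinj x h1 h2
    exact ⟨y, hy, Prod.ext e f⟩
  · rintro ⟨y, hy, rfl⟩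
    refine ⟨fun h => ?_, ha.adj x y hy, hb.adj x y hy⟩
    have h1 := one_ne_zero_zmod hr
    have h : a x = a y := congrArg Prod.fst h
    rcases ha.adj x y hy with e | e
    · exact h1 (by linear_combination -e - h)
    · exact h1 (by linear_combination e + h)

theorem arcsG_iff_exists (hA : Bidirectional Δ a) (hΓ : IsOG4 Γ G Δ) (ha : CycleLabel Γ G a)
    (hb : ∀ x y, (x, y) ∈ Δ → b y = b x + 1) (x : V) (w : X r s) :
    ((a x, b x), w) ∈ arcsG r s ↔ ∃ y, (x, y) ∈ Δ ∧ (a y, b y) = w := by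
  rw [mem_arcsG]
  constructor
  · rintro ⟨h | h, h'⟩
    · obtain ⟨y, hy, e⟩ := hA.out_up x
      exact ⟨y, hy, Prod.ext (e.trans h.symm) ((hb x y hy).trans h'.symm)⟩
    · obtain ⟨y, hy, e⟩ := hA.out_down x
      exact ⟨y, hy, Prod.ext (e.trans h.symm) ((hb x y hy).trans h'.symm)⟩
  · rintro ⟨y, hy, rfl⟩
    exact ⟨ha.adj x y (hΓ.adj_of_mem _ _ hy), hb x y hy⟩

/-- The two directions of the arcs out of a vertex are realized. -/
theorem IsSlope.iff_exists {e : V → ZMod 2} (he : IsSlope Δ a b e) (hA : Bidirectional Δ a)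
    (hr : 3 ≤ r) (x : V) (i : ZMod r) (j : ZMod s) :
    ((i = a x + 1 ∧ j = b x + sgnTwo s (e x)) ∨ (i = a x - 1 ∧ j = b x - sgnTwo s (e x))) ↔
      ∃ y, (x, y) ∈ Δ ∧ a y = i ∧ b y = j := by
  constructor
  · rintro (⟨rfl, rfl⟩ | ⟨rfl, rfl⟩)
    · obtain ⟨y, hy, e⟩ := hA.out_up x
      exact ⟨y, hy, e, he.b_of_up hr hy e⟩
    · obtain ⟨y, hy, e⟩ := hA.out_down x
      exact ⟨y, hy, e, he.b_of_down hr hy e⟩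
  · rintro ⟨y, hy, rfl, rfl⟩
    exact he x y hy

theorem eq_of_label_eq (hΓ : IsOG4 Γ G Δ) (hr : 3 ≤ r) (hs : 3 ≤ s) (ha : CycleLabel Γ G a)
    (hb : CycleLabel Γ G b) (hA : Bidirectional Δ a)
    (hfaith : ∀ g : G, (∀ v, a (g • v) = a v ∧ b (g • v) = b v) → g = 1) {x x' y y' : V}
    (ex : a x = a x') (fx : b x = b x') (hy : (x, y) ∈ Δ) (hy' : (x', y') ∈ Δ)
    (ey : a y' = a y) (fy : b y = b y') : x = x' := by
  obtain ⟨g, hg, hg'⟩ := hA.exists_smul_fixing hΓ hr hs ha hb ex fx hy hy' ey fy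
  rw [hfaith g hg', one_smul] at hg
  exact hg

/-- Both sides change by 1 along every edge and agree at the base vertex. Thus a label of even
modulus determines an alternating slope. -/
theorem parity_label {n : ℕ} {c : V → ZMod n} (hn : Even n) (hΓ : Γ.Connected)
    (hc : CycleLabel Γ G c) {e : V → ZMod 2} (he : ∀ x y, Γ.Adj x y → e y = e x + 1) {x₀ : V}
    (hcx : c x₀ = 0) (hex : e x₀ = 0) (v : V) : parity hn (c v) = e v := by
  have hneg : ∀ δ : ZMod 2, δ - 1 = δ + 1 := by decide
  refine connected_induction hΓ (P := fun v => parity hn (c v) = e v) x₀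
    (by rw [hcx, hex, map_zero]) (fun v w hvw hv => ?_) v
  rcases hc.adj v w hvw with h | h
  · rw [h, map_add, map_one, hv, he v w hvw]
  · rw [h, map_sub, map_one, hv, he v w hvw, hneg]

/-- An odd modulus allows integer representatives of equal parity to be chosen for any pair. -/
theorem prod_surjective (hΓ : IsOG4 Γ G Δ) (ha : CycleLabel Γ G a) (hb : CycleLabel Γ G b)
    (hinj : ∀ x w w', Γ.Adj x w → Γ.Adj x w' → a w = a w' → b w = b w' → w = w') {x₀ : V}
    (hax : a x₀ = 0) (hbx : b x₀ = 0) [NeZero r] [NeZero s] (hodd : Odd r ∨ Odd s)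
    (i : ZMod r) (j : ZMod s) : ∃ v, a v = i ∧ b v = j := by
  have key : ∀ m n : ℤ, (m : ZMod r) = i → (n : ZMod s) = j → Even (m - n) →
      ∃ v, a v = i ∧ b v = j := by
    rintro m n rfl rfl h
    obtain ⟨v, h1, h2, -⟩ := exists_label_of_even hΓ ha hb hinj hax hbx (e := fun _ => 0) (c := 0)
      (fun _ _ _ => rfl) rfl h
    exact ⟨v, h1, h2⟩
  rcases hodd with h | h
  · obtain ⟨m, hm, he⟩ := exists_intCast_eq_of_odd h i j.val
    exact key m j.val hm (by simp) he
  · obtain ⟨n, hn, he⟩ := exists_intCast_eq_of_odd h j i.val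
    exact key i.val n (by simp) hn (by rw [← neg_sub]; exact he.neg)

theorem prod_surjective_of_even (hΓ : IsOG4 Γ G Δ) (ha : CycleLabel Γ G a)
    (hb : CycleLabel Γ G b)
    (hinj : ∀ x w w', Γ.Adj x w → Γ.Adj x w' → a w = a w' → b w = b w' → w = w') {x₀ : V}
    (hax : a x₀ = 0) (hbx : b x₀ = 0) [NeZero r] [NeZero s] {p : X r s} (hp : p ∈ Xplus r s) :
    ∃ v, a v = p.1 ∧ b v = p.2 := by
  obtain ⟨v, h1, h2, -⟩ := exists_label_of_even hΓ ha hb hinj hax hbx (e := fun _ => 0) (c := 0)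
    (fun _ _ _ => rfl) rfl (m := p.1.val) (n := p.2.val) (by
      rw [Int.even_sub, Int.even_coe_nat, Int.even_coe_nat]
      exact hp)
  exact ⟨v, by simpa using h1, by simpa using h2⟩

theorem neg_one_ne_one_zmod {n : ℕ} (hn : 3 ≤ n) : (-1 : ZMod n) ≠ 1 := fun h =>
  two_ne_zero_zmod hn (by linear_combination -h)

theorem pairIso_plus (hΓ : IsOG4 Γ G Δ) (hr : 3 ≤ r) (ha : CycleLabel Γ G a)
    (hb : CycleLabel Γ G b) (hA : Bidirectional Δ a)
    (hinj : ∀ x w w', Γ.Adj x w → Γ.Adj x w' → a w = a w' → b w = b w' → w = w') {x₀ : V}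
    (hax : a x₀ = 0) (hbx : b x₀ = 0) [NeZero r] [NeZero s] (hre : Even r) (hse : Even s)
    (hL : ∀ x y, a x = a y → b x = b y → x = y) {Δ' : Set (X r s × X r s)}
    {K : Subgroup (Equiv.Perm (Xplus r s))}
    (hout : ∀ x w, ((a x, b x), w) ∈ Δ' ↔ ∃ y, (x, y) ∈ Δ ∧ (a y, b y) = w)
    (hK : K ≤ coordAut (arcsPlus Δ') (Subtype.val : Xplus r s → X r s))
    (hreach : ∀ w₀ w : Xplus r s, (w₀ : X r s) = (0, 0) → (GamPlus r s).Adj w₀ w →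
      Reaches K w₀ w)
    (hstab : ∃ k ∈ K, (∀ p : Xplus r s, (p : X r s) = (0, 0) → k p = p) ∧ k ≠ 1) :
    PairIso Γ G Δ (GamPlus r s) K (arcsPlus Δ') := by
  have hflip : ∀ δ : ZMod 2, δ - 1 = δ + 1 := by decide
  have hmem : ∀ v, (a v, b v) ∈ Xplus r s := by
    refine connected_induction hΓ.connected x₀ ?_ fun v w hvw hv => ?_
    · rw [mem_Xplus_iff hre hse, hax, hbx, map_zero, map_zero]
    · rw [mem_Xplus_iff hre hse] at hv ⊢
      simp only at hv ⊢
      rcases ha.adj v w hvw with h | h <;> rcases hb.adj v w hvw with h' | h' <;>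
        simp only [h, h', map_add, map_sub, map_one, hv, hflip]
  let F : V → Xplus r s := fun v => ⟨(a v, b v), hmem v⟩
  have hF : ∀ (y : V) (w : Xplus r s), (a y, b y) = (w : X r s) ↔ F y = w := fun y w =>
    ⟨fun h => Subtype.ext h, fun h => congrArg Subtype.val h⟩
  have hF₀ : (F x₀ : X r s) = (0, 0) := Prod.ext hax hbx
  refine pairIso_of_labels hΓ hr ha hA x₀ (fun p => p.1.1) F ⟨?_, ?_⟩ (fun _ => rfl) ?_ ?_
    (hK.trans inf_le_left) (fun w h => hreach _ _ hF₀ h) ?_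
  · intro x y h
    have h : (a x, b x) = (a y, b y) := congrArg Subtype.val h
    rw [Prod.mk.injEq] at h
    exact hL x y h.1 h.2
  · rintro ⟨p, hp⟩
    obtain ⟨v, h1, h2⟩ := prod_surjective_of_even hΓ ha hb hinj hax hbx hp
    exact ⟨v, Subtype.ext (Prod.ext h1 h2)⟩
  · intro x w
    refine (hout x w).trans ?_
    simp only [hF]
  · intro x w
    refine (Gam_adj_iff_exists hΓ hr ha hb hinj x w).trans ?_
    simp only [hF]
  · obtain ⟨k, hk, h, h1⟩ := hstab
    exact ⟨k, hk, h _ hF₀, h1⟩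

/-- When `b` always rises by 1, vertices with equal label pairs have upper out-neighbours with equal
label pairs, so an element fixing all labels relates them and they coincide. The parity of `r` and
`s` then decides between all of `X r s` and `Xplus r s`. -/
theorem tableLine_of_oriented (hΓ : IsOG4 Γ G Δ) (hr : 3 ≤ r) (hs : 3 ≤ s)
    (ha : CycleLabel Γ G a) (hb : CycleLabel Γ G b) (hA : Bidirectional Δ a)
    (hinj : ∀ x w w', Γ.Adj x w → Γ.Adj x w' → a w = a w' → b w = b w' → w = w')
    (hfaith : ∀ g : G, (∀ v, a (g • v) = a v ∧ b (g • v) = b v) → g = 1) {x₀ : V}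
    (hax : a x₀ = 0) (hbx : b x₀ = 0) (hasc : ∀ x y, (x, y) ∈ Δ → b y = b x + 1) :
    TableLine r s Γ G Δ true := by
  have : NeZero r := ⟨by omega⟩
  have : NeZero s := ⟨by omega⟩
  have hL : ∀ x y, a x = a y → b x = b y → x = y := by
    intro x x' h h'
    obtain ⟨y, hy, e⟩ := hA.out_up x
    obtain ⟨y', hy', e'⟩ := hA.out_up x'
    exact eq_of_label_eq hΓ hr hs ha hb hA hfaith h h' hy hy' (by rw [e, e', h])
      (by rw [hasc _ _ hy, hasc _ _ hy', h'])
  by_cases hodd : Odd r ∨ Odd s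
  · refine .line1 hodd ?_
    have h₀ : (a x₀, b x₀) = ((0, 0) : X r s) := Prod.ext hax hbx
    refine pairIso_of_labels hΓ hr ha hA x₀ (fun p => p.1) (fun v => (a v, b v)) ⟨?_, ?_⟩
      (fun _ => rfl) (arcsG_iff_exists hA hΓ ha hasc) (Gam_adj_iff_exists hΓ hr ha hb hinj)
      (Grp_le_coordAut.trans inf_le_left) ?_ ?_
    · intro x y h
      rw [Prod.mk.injEq] at h
      exact hL x y h.1 h.2
    · rintro ⟨i, j⟩
      obtain ⟨v, h1, h2⟩ := prod_surjective hΓ ha hb hinj hax hbx hodd i j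
      exact ⟨v, Prod.ext h1 h2⟩
    · rw [h₀]
      exact fun w h => reaches_Grp h
    · rw [h₀]
      refine ⟨sigma r s, Subgroup.subset_closure (by simp), by simp [sigma_apply], fun h => ?_⟩
      have := congrArg (fun p => (p ((1, 0) : X r s)).1) h
      exact neg_one_ne_one_zmod hr this
  · rw [not_or, Nat.not_odd_iff_even, Nat.not_odd_iff_even] at hodd
    obtain ⟨hre, hse⟩ := hodd
    refine .line2 hre hse (pairIso_plus hΓ hr ha hb hA hinj hax hbx hre hse hL
      (arcsG_iff_exists hA hΓ ha hasc) GrpPlus_le_coordAut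
      (fun _ _ h₀ h => reaches_GrpPlus hre hse h₀ h) ?_)
    obtain ⟨-, t, ht, et⟩ := exists_mem_GrpPlus hre hse
    refine ⟨t, ht, fun p hp => Subtype.ext (by rw [et, hp]; simp), fun h => ?_⟩
    have := et ⟨(1, 1), one_one_mem_Xplus hre hse⟩
    rw [h] at this
    exact neg_one_ne_one_zmod hr (congrArg Prod.fst this).symm

/-- The triple `(a, b, e)` separates vertices. If `s` is even, `e` is the parity of `b`; if only `r`
is even, it is the parity of `a` and the coordinates are exchanged; if both are odd, all triples
occur. -/
theorem tableLine_of_slope (hΓ : IsOG4 Γ G Δ) (hr : 3 ≤ r) (hs : 3 ≤ s)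
    (ha : CycleLabel Γ G a) (hb : CycleLabel Γ G b) (hA : Bidirectional Δ a)
    (hinj : ∀ x w w', Γ.Adj x w → Γ.Adj x w' → a w = a w' → b w = b w' → w = w')
    (hfaith : ∀ g : G, (∀ v, a (g • v) = a v ∧ b (g • v) = b v) → g = 1) {x₀ : V}
    (hax : a x₀ = 0) (hbx : b x₀ = 0) {e : V → ZMod 2} (he : IsSlope Δ a b e)
    (hflip : ∀ x y, Γ.Adj x y → e y = e x + 1) (hex : e x₀ = 0) :
    TableLine r s Γ G Δ false := by
  have : NeZero r := ⟨by omega⟩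
  have : NeZero s := ⟨by omega⟩
  have hLe : ∀ x y, a x = a y → b x = b y → e x = e y → x = y := by
    intro x x' h h' h''
    obtain ⟨y, hy, f⟩ := hA.out_up x
    obtain ⟨y', hy', f'⟩ := hA.out_up x'
    exact eq_of_label_eq hΓ hr hs ha hb hA hfaith h h' hy hy' (by rw [f, f', h])
      (by rw [he.b_of_up hr hy f, he.b_of_up hr hy' f', h', h''])
  rcases Nat.even_or_odd s with hse | hso
  · have hpar : ∀ v, parity hse (b v) = e v := parity_label hse hΓ.connected hb hflip hbx hex
    have hL : ∀ x y, a x = a y → b x = b y → x = y := fun x y h h' =>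
      hLe x y h h' (by rw [← hpar, ← hpar, h'])
    have hout : ∀ (x : V) (w : X r s),
        ((a x, b x), w) ∈ arcsH r s ↔ ∃ y, (x, y) ∈ Δ ∧ (a y, b y) = w := by
      intro x w
      rw [mem_arcsH, sgn_eq_sgnTwo hse]
      simp only [hpar, Prod.ext_iff]
      exact he.iff_exists hA hr x w.1 w.2
    rcases Nat.even_or_odd r with hre | hro
    · refine .line5 hre hse (pairIso_plus hΓ hr ha hb hA hinj hax hbx hre hse hL hout
        (HrpPlus_le_coordAut hse) (fun _ _ h₀ h => reaches_HrpPlus hre hse h₀ h) ?_)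
      obtain ⟨-, -, t, ht, et⟩ := exists_mem_HrpPlus hre hse
      refine ⟨t, ht, fun p hp => Subtype.ext (by rw [et, hp]; simp), fun h => ?_⟩
      have := et ⟨(1, 1), one_one_mem_Xplus hre hse⟩
      rw [h] at this
      exact neg_one_ne_one_zmod hr (congrArg Prod.fst this).symm
    · refine .line3 hro hse ?_
      have h₀ : (a x₀, b x₀) = ((0, 0) : X r s) := Prod.ext hax hbx
      refine pairIso_of_labels hΓ hr ha hA x₀ (fun p => p.1) (fun v => (a v, b v)) ⟨?_, ?_⟩
        (fun _ => rfl) hout (Gam_adj_iff_exists hΓ hr ha hb hinj)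
        ((Hrp_le_coordAut hse).trans inf_le_left) ?_ ?_
      · intro x y h
        rw [Prod.mk.injEq] at h
        exact hL x y h.1 h.2
      · rintro ⟨i, j⟩
        obtain ⟨v, h1, h2⟩ := prod_surjective hΓ ha hb hinj hax hbx (.inl hro) i j
        exact ⟨v, Prod.ext h1 h2⟩
      · rw [h₀]
        exact fun w h => reaches_Hrp h
      · rw [h₀]
        refine ⟨tau r s, Subgroup.subset_closure (by simp), by simp [tau_apply], fun h => ?_⟩
        have := congrArg (fun p => (p ((1, 0) : X r s)).1) h
        exact neg_one_ne_one_zmod hr this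
  · rcases Nat.even_or_odd r with hre | hro
    · refine .line4 hre hso ?_
      have hpar : ∀ v, parity hre (a v) = e v := parity_label hre hΓ.connected ha hflip hax hex
      have h₀ : (b x₀, a x₀) = ((0, 0) : X s r) := Prod.ext hbx hax
      -- After the exchange of coordinates, the label `a` is the second coordinate of the model.
      refine pairIso_of_labels hΓ hr ha hA x₀ (fun p => p.2) (fun v => (b v, a v)) ⟨?_, ?_⟩
        (fun _ => rfl) ?_
        (Gam_adj_iff_exists hΓ hs hb ha fun x w w' h h' e f => hinj x w w' h h' f e)
        ((Hrp_le_coordAut hre).trans inf_le_right) ?_ ?_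
      · intro x y h
        rw [Prod.mk.injEq] at h
        exact hLe x y h.2 h.1 (by rw [← hpar, ← hpar, h.2])
      · rintro ⟨j, i⟩
        obtain ⟨v, h1, h2⟩ := prod_surjective hΓ ha hb hinj hax hbx (.inr hso) i j
        exact ⟨v, Prod.ext h2 h1⟩
      · rintro x ⟨j, i⟩
        have := he.iff_exists hA hr x i j
        rw [mem_arcsH, sgn_eq_sgnTwo hre]
        simp only [hpar, Prod.mk.injEq, and_comm (a := b _ = j)]
        rw [← this]
        -- The set `±(1, ε)` with `ε = ±1` is invariant under exchange of coordinates; for `ε = -1`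
        -- its two members are interchanged.
        rcases zmod_two_cases (e x) with h | h <;> rw [h]
        · simp only [sgnTwo_zero]
          tauto
        · simp only [sgnTwo_one, sub_neg_eq_add, ← sub_eq_add_neg]
          tauto
      · rw [h₀]
        exact fun w h => reaches_Hrp h
      · rw [h₀]
        refine ⟨tau s r, Subgroup.subset_closure (by simp), by simp [tau_apply], fun h => ?_⟩
        have := congrArg (fun p => (p ((0, 1) : X s r)).2) h
        exact neg_one_ne_one_zmod hr this
    · refine .line6 hro hso ?_
      have h₀ : ((a x₀, b x₀), e x₀) = (((0, 0), 0) : X r s × ZMod 2) := by rw [hax, hbx, hex]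
      refine pairIso_of_labels hΓ hr ha hA x₀ (fun p => p.1.1) (fun v => ((a v, b v), e v))
        ⟨?_, ?_⟩ (fun _ => rfl) ?_ ?_ (Grp2_le_coordAut.trans inf_le_left) ?_ ?_
      · intro x y h
        simp only [Prod.mk.injEq] at h
        exact hLe x y h.1.1 h.1.2 h.2
      · rintro ⟨⟨i, j⟩, δ⟩
        -- The representative `m` of `i` is chosen with the parity `δ`, which fixes the slope
        -- reached, and then `n` representing `j` with the parity of `m`.
        obtain ⟨m, hm, hmδ⟩ := exists_intCast_eq_of_odd hro i (δ.val : ℤ)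
        obtain ⟨n, hn, hnm⟩ := exists_intCast_eq_of_odd hso j m
        obtain ⟨v, h1, h2, h3⟩ := exists_label_of_even hΓ ha hb hinj hax hbx hflip hex
          (m := m) (n := n) (by rw [← neg_sub]; exact hnm.neg)
        have hδ : (m : ZMod 2) = δ := by
          have : ((m - (δ.val : ℤ) : ℤ) : ZMod 2) = 0 :=
            (ZMod.intCast_zmod_eq_zero_iff_dvd _ 2).mpr hmδ.two_dvd
          push_cast at this
          rw [ZMod.natCast_zmod_val] at this
          exact sub_eq_zero.mp this
        exact ⟨v, by simp only [h1, h2, h3, hm, hn, mul_one, hδ]⟩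
      · rintro x ⟨⟨i, j⟩, δ⟩
        rw [mem_arcs2]
        simp only [Prod.mk.injEq]
        rw [he.iff_exists hA hr x i j]
        constructor
        · rintro ⟨hδ, y, hy, h⟩
          exact ⟨y, hy, h, by rw [hflip x y (hΓ.adj_of_mem _ _ hy), hδ]⟩
        · rintro ⟨y, hy, h, hδ⟩
          exact ⟨by rw [← hδ, hflip x y (hΓ.adj_of_mem _ _ hy)], y, hy, h⟩
      · rintro x ⟨p, δ⟩
        have hne : ∀ δ δ' : ZMod 2, δ ≠ δ' ↔ δ + 1 = δ' := by decide
        change e x ≠ δ ∧ (Gam r s).Adj (a x, b x) p ↔ _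
        rw [Gam_adj_iff_exists hΓ hr ha hb hinj, hne]
        constructor
        · rintro ⟨hδ, y, hy, rfl⟩
          exact ⟨y, hy, by rw [hflip x y hy, hδ]⟩
        · rintro ⟨y, hy, h⟩
          rw [Prod.mk.injEq] at h
          exact ⟨by rw [← hflip x y hy, h.2], y, hy, h.1⟩
      · rw [h₀]
        exact fun w h => reaches_Grp2 h
      · rw [h₀]
        refine ⟨(tau r s).prodCongr (Equiv.refl _), Subgroup.subset_closure (by simp),
          by simp [tau_apply], fun h => ?_⟩
        have := congrArg (fun p => (p (((1, 0), 0) : X r s × ZMod 2)).1.1) h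
        exact neg_one_ne_one_zmod hr this

theorem Bidirectional.add_const {n : ℕ} {c : V → ZMod n} (h : Bidirectional Δ c) (d : ZMod n) :
    Bidirectional Δ fun x => c x + d where
  out_up x := by obtain ⟨y, hy, e⟩ := h.out_up x; exact ⟨y, hy, by rw [e]; ring⟩
  out_down x := by obtain ⟨y, hy, e⟩ := h.out_down x; exact ⟨y, hy, by rw [e]; ring⟩
  in_up x := by obtain ⟨y, hy, e⟩ := h.in_up x; exact ⟨y, hy, by rw [e]; ring⟩
  in_down x := by obtain ⟨y, hy, e⟩ := h.in_down x; exact ⟨y, hy, by rw [e]; ring⟩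

/-- Translations of the labels put the base vertex at `(0, 0)`. Replacing `b` by `-b`, if needed,
makes arcs ascend in the oriented case and makes the slope at the base vertex 0 in the other. -/
theorem exists_tableLine (hΓ : IsOG4 Γ G Δ) (hr : 3 ≤ r) (hs : 3 ≤ s) (ha : CycleLabel Γ G a)
    (hb : CycleLabel Γ G b) (hA : Bidirectional Δ a) {T : Subgroup G}
    (hT : ∀ g, g ∈ T ↔ ∀ v, a (g • v) = a v ∧ b (g • v) = b v) (hbot : T = ⊥)
    (hcyc : ¬ IsCycleGraph (normalQuotient Γ T)) :
    ∃ β : Bool, TableLine r s Γ G Δ β ∧ (Oriented Δ b ↔ β = true) := by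
  obtain ⟨x₀⟩ := hΓ.connected.nonempty
  have hne := hΓ.connected.nonempty
  have hfaith : ∀ g : G, (∀ v, a (g • v) = a v ∧ b (g • v) = b v) → g = 1 := fun g hg => by
    have := (hT g).mpr hg
    rwa [hbot, Subgroup.mem_bot] at this
  have hinj : ∀ x w w', Γ.Adj x w → Γ.Adj x w' → a w = a w' → b w = b w' → w = w' :=
    fun x w w' => label_injective_on_neighbors hΓ hr hs ha hb hA hT hcyc
  have ha' := ha.add_const (-a x₀)
  have hb' := hb.add_const (-b x₀)
  have hA' := hA.add_const (-a x₀)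
  rcases hb.oriented_or_bidirectional hΓ hs with ho | hB
  · refine ⟨true, ?_, by simp [ho]⟩
    rcases ho with ho | ho
    · exact tableLine_of_oriented hΓ hr hs ha' hb' hA'
        (fun x w w' h h' e f => hinj x w w' h h' (add_right_cancel e) (add_right_cancel f))
        (fun g hg => hfaith g fun v =>
          ⟨add_right_cancel (hg v).1, add_right_cancel (hg v).2⟩) (x₀ := x₀)
        (add_neg_cancel _) (add_neg_cancel _) (fun x y h => by rw [ho x y h]; ring)
    · exact tableLine_of_oriented hΓ hr hs ha' hb'.neg hA'
        (fun x w w' h h' e f => hinj x w w' h h' (add_right_cancel e)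
          (add_right_cancel (neg_injective f)))
        (fun g hg => hfaith g fun v =>
          ⟨add_right_cancel (hg v).1, add_right_cancel (neg_injective (hg v).2)⟩) (x₀ := x₀)
        (add_neg_cancel _) (by simp) (fun x y h => by rw [ho x y h]; ring)
  · refine ⟨false, ?_, by simp [hB.not_oriented hs]⟩
    obtain ⟨e, he⟩ := exists_isSlope hΓ hr hs ha hb hA hB
    have hflip : ∀ x y, Γ.Adj x y → e y = e x + 1 := by
      have h2 : ∀ δ : ZMod 2, δ = δ + 1 + 1 := by decide
      intro x y h
      rcases hΓ.adj_iff.mp h with h | h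
      · exact he.flip hΓ hr hs ha hb hA hT hcyc h
      · rw [he.flip hΓ hr hs ha hb hA hT hcyc h, ← h2]
    rcases zmod_two_cases (e x₀) with hex | hex
    · refine tableLine_of_slope hΓ hr hs ha' hb' hA'
        (fun x w w' h h' e f => hinj x w w' h h' (add_right_cancel e) (add_right_cancel f))
        (fun g hg => hfaith g fun v =>
          ⟨add_right_cancel (hg v).1, add_right_cancel (hg v).2⟩) (x₀ := x₀)
        (add_neg_cancel _) (add_neg_cancel _) (e := e) (fun x y h => ?_) hflip hex
      rcases he x y h with ⟨p, q⟩ | ⟨p, q⟩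
      · exact .inl ⟨by rw [p]; ring, by rw [q]; ring⟩
      · exact .inr ⟨by rw [p]; ring, by rw [q]; ring⟩
    -- Negating `b` reverses every slope, hence `e x + 1`.
    · refine tableLine_of_slope hΓ hr hs ha' hb'.neg hA'
        (fun x w w' h h' e f => hinj x w w' h h' (add_right_cancel e)
          (add_right_cancel (neg_injective f)))
        (fun g hg => hfaith g fun v =>
          ⟨add_right_cancel (hg v).1, add_right_cancel (neg_injective (hg v).2)⟩) (x₀ := x₀)
        (add_neg_cancel _) (by simp) (e := fun x => e x + 1) (fun x y h => ?_)
        (fun x y h => by rw [hflip x y h]) (by rw [hex]; rfl)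
      simp only [sgnTwo_add_one]
      rcases he x y h with ⟨p, q⟩ | ⟨p, q⟩
      · exact .inl ⟨by rw [p]; ring, by rw [q]; ring⟩
      · exact .inr ⟨by rw [p]; ring, by rw [q]; ring⟩

end Classification

end OG

/-! ### The main theorem -/

open OG in
theorem theorem1p2 {V : Type u} {G : Type v} [Group G] [MulAction G V]
    (Γ : SimpleGraph V) (Δ : Set (V × V)) (hΓ : IsOG4 Γ G Δ) (x : V)
    (N M : Subgroup G) [N.Normal] [M.Normal] (r s : ℕ) (hr : 3 ≤ r) (hs : 3 ≤ s)
    (hN : Nonempty (normalQuotient Γ N ≃g SimpleGraph.cycleGraph r))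
    (hM : Nonempty (normalQuotient Γ M ≃g SimpleGraph.cycleGraph s))
    (hind : Independent Γ N M) :
    Nonempty (MulAction.stabilizer G x ≃* Multiplicative (ZMod 2)) ∧
    -- (a)
    (¬ QuotientOriented Γ Δ N ∨ ¬ QuotientOriented Γ Δ M) ∧
    -- The covered pair is `(Γ_T, G ⧸ T)`, where `T` is the intersection of the kernels of `G` on
    -- the `N`-orbits and on the `M`-orbits, and `N'`, `M'` are the images of these kernels.
    ∃ (T : Subgroup G) (_ : T.Normal) (N' M' : Subgroup (G ⧸ T)),
      T = orbitKernel N V ⊓ orbitKernel M V ∧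
      N' = (orbitKernel N V).map (QuotientGroup.mk' T) ∧
      M' = (orbitKernel M V).map (QuotientGroup.mk' T) ∧
      -- (b)
      (IsNormalCover Γ T ∧
        IsOG4 (normalQuotient Γ T) (G ⧸ T) (quotientArcs Δ T) ∧
        N'.Normal ∧ M'.Normal ∧
        Nonempty (normalQuotient (normalQuotient Γ T) N' ≃g SimpleGraph.cycleGraph r) ∧
        Nonempty (normalQuotient (normalQuotient Γ T) M' ≃g SimpleGraph.cycleGraph s) ∧
        Independent (normalQuotient Γ T) N' M' ∧
        N' ⊓ M' = ⊥) ∧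
      -- (c), where `Γ_N` is an unoriented quotient
      (¬ QuotientOriented Γ Δ N →
        ∃ b : Bool,
          TableLine r s (normalQuotient Γ T) (G ⧸ T) (quotientArcs Δ T) b ∧
          (QuotientOriented (normalQuotient Γ T) (quotientArcs Δ T) M' ↔ b = true) ∧
          (QuotientOriented Γ Δ M ↔ b = true)) := by
  have hne := hΓ.connected.nonempty
  obtain ⟨a, ha, haN⟩ := exists_cycleLabel hΓ N hr hN
  obtain ⟨b, hb, hbM⟩ := exists_cycleLabel hΓ M hs hM
  have hoN := quotientOriented_iff hΓ hr ha haN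
  have hoM := quotientOriented_iff hΓ hs hb hbM
  obtain ⟨T, hTdef⟩ : ∃ T, T = orbitKernel N V ⊓ orbitKernel M V := ⟨_, rfl⟩
  have hTn : T.Normal := by rw [hTdef]; infer_instance
  have hcyc : ¬ IsCycleGraph (normalQuotient Γ T) := by rw [hTdef]; exact hind
  have hT : ∀ g, g ∈ T ↔ ∀ v, a (g • v) = a v ∧ b (g • v) = b v := fun g => by
    rw [hTdef, Subgroup.mem_inf, mem_orbitKernel_iff haN, mem_orbitKernel_iff hbM, forall_and]
  have hT' : ∀ g, g ∈ T ↔ ∀ v, b (g • v) = b v ∧ a (g • v) = a v := fun g => by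
    rw [hT]; simp only [and_comm]
  -- Independence excludes two oriented labels; this yields (a) and a bidirectional label for the
  -- stabilizer.
  have hbi : Bidirectional Δ a ∨ Bidirectional Δ b := by
    rcases ha.oriented_or_bidirectional hΓ hr with h | h
    · rcases hb.oriented_or_bidirectional hΓ hs with h' | h'
      · exact absurd (isCycleGraph_of_oriented hΓ hr hs ha hb hT h h') hcyc
      · exact .inr h'
    · exact .inl h
  have hinj : ∀ x w w', Γ.Adj x w → Γ.Adj x w' → a w = a w' → b w = b w' → w = w' := by
    intro x w w' h h' e f
    rcases hbi with hA | hB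
    · exact label_injective_on_neighbors hΓ hr hs ha hb hA hT hcyc h h' e f
    · exact label_injective_on_neighbors hΓ hs hr hb ha hB hT' hcyc h h' f e
  have hcover := isNormalCover_of_label_injective hΓ hT hinj
  have hΓT := isOG4_quotient hΓ hr ha hT hcover
  have hTN : T ≤ orbitKernel N V := hTdef ▸ inf_le_left
  have hTM : T ≤ orbitKernel M V := hTdef ▸ inf_le_right
  have hadj := fun x y => quotient_adj_of_adj (x := x) (y := y) hr ha hT
  have hTa : ∀ x y : V, orb T x = orb T y → a x = a y := fun x y h => (label_eq_of_orb_eq hT h).1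
  have hTb : ∀ x y : V, orb T x = orb T y → b x = b y := fun x y h => (label_eq_of_orb_eq hT h).2
  have haT := ha.quotientLabel hTa hadj
  have hbT := hb.quotientLabel hTb hadj
  obtain ⟨N', hN'⟩ : ∃ N', N' = (orbitKernel N V).map (QuotientGroup.mk' T) := ⟨_, rfl⟩
  obtain ⟨M', hM'⟩ : ∃ M', M' = (orbitKernel M V).map (QuotientGroup.mk' T) := ⟨_, rfl⟩
  have horbN : ∀ x y : V, orb N' (orb T x) = orb N' (orb T y) ↔ orb N x = orb N y := by
    rw [hN']; exact orb_map_orbitKernel_iff hTN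
  have horbM : ∀ x y : V, orb M' (orb T x) = orb M' (orb T y) ↔ orb M x = orb M y := by
    rw [hM']; exact orb_map_orbitKernel_iff hTM
  have haN' : ∀ B C, quotientLabel T a hTa B = quotientLabel T a hTa C ↔ orb N' B = orb N' C := by
    intro B C
    induction B using Quotient.inductionOn with | _ x
    induction C using Quotient.inductionOn with | _ y
    exact (haN x y).trans (horbN x y).symm
  have hbM' : ∀ B C, quotientLabel T b hTb B = quotientLabel T b hTb C ↔ orb M' B = orb M' C := by
    intro B C
    induction B using Quotient.inductionOn with | _ x
    induction C using Quotient.inductionOn with | _ y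
    exact (hbM x y).trans (horbM x y).symm
  let S : Subgroup (G ⧸ T) := orbitKernel N' (Orbits T V) ⊓ orbitKernel M' (Orbits T V)
  have hS : ∀ g, g ∈ S ↔ ∀ v, quotientLabel T a hTa (g • v) = quotientLabel T a hTa v ∧
      quotientLabel T b hTb (g • v) = quotientLabel T b hTb v := fun g => by
    rw [Subgroup.mem_inf, mem_orbitKernel_iff haN', mem_orbitKernel_iff hbM', forall_and]
  -- An element of `G ⧸ T` fixing all induced labels is represented by an element fixing all labels,
  -- that is, by one of `T`.
  have hSbot : S = ⊥ := by
    rw [eq_bot_iff]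
    intro q hq
    induction q using QuotientGroup.induction_on with | _ g
    rw [Subgroup.mem_bot, QuotientGroup.eq_one_iff, hT]
    exact fun v => (hS _).mp hq (orb T v)
  have hSind : Independent (normalQuotient Γ T) N' M' := by
    intro h
    -- As `S` is trivial, the further quotient by `S` is the quotient by `T` itself, which is not a
    -- cycle.
    obtain ⟨f⟩ := nonempty_iso_quotient_quotient (Γ := Γ) (T := T) (K := T) (L := S) fun x y => by
      refine ⟨fun h => ?_, fun h => by rw [h]⟩
      obtain ⟨q, hq, e⟩ := exists_smul_of_orb_eq h
      rw [hSbot, Subgroup.mem_bot] at hq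
      rw [← e, hq, one_smul]
    exact hcyc (h.of_iso f)
  refine ⟨?_, ?_, T, hTn, N', M', hTdef, hN', hM', ⟨hcover, hΓT, ?_, ?_, ?_, ?_, hSind, ?_⟩, ?_⟩
  · rcases hbi with h | h
    · exact h.nonempty_stabilizer_mulEquiv hΓ hr ha x
    · exact h.nonempty_stabilizer_mulEquiv hΓ hs hb x
  · rw [hoN, hoM]
    rcases hbi with h | h
    · exact .inl (h.not_oriented hr)
    · exact .inr (h.not_oriented hs)
  · rw [hN']
    exact Subgroup.Normal.map inferInstance _ (QuotientGroup.mk'_surjective T)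
  · rw [hM']
    exact Subgroup.Normal.map inferInstance _ (QuotientGroup.mk'_surjective T)
  · obtain ⟨f⟩ := nonempty_iso_quotient_quotient (Γ := Γ) horbN
    exact hN.map f.trans
  · obtain ⟨f⟩ := nonempty_iso_quotient_quotient (Γ := Γ) horbM
    exact hM.map f.trans
  · rw [eq_bot_iff, ← hSbot]
    exact inf_le_inf (le_orbitKernel N') (le_orbitKernel M')
  · intro hun
    have hun' : ¬ Oriented (quotientArcs Δ T) (quotientLabel T a hTa) := by
      rwa [oriented_quotientLabel_iff, ← hoN]
    obtain ⟨β, hline, hβ⟩ := exists_tableLine hΓT hr hs haT hbT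
      ((haT.oriented_or_bidirectional hΓT hr).resolve_left hun') hS hSbot hSind
    refine ⟨β, hline, ?_, ?_⟩
    · rw [quotientOriented_iff hΓT hs hbT hbM', hβ]
    · rw [hoM, ← hβ, oriented_quotientLabel_iff]
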